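/- Let $\mathcal H^{I_1},\mathcal H^{O_1},\mathcal H^{I_2},\mathcal H^{O_2}$ be finite-dimensional Hilbert spaces with $d_{I_1}=d_{I_2}$ and $d_{O_1}=d_{O_2}$, and write ${}_XA:=\mathrm{Tr}_X A\otimes \mathbb 1^X/d_X$. Call a positive semidefinite operator $W$ on $\mathcal H^{I_1}\otimes\mathcal H^{O_1}\otimes\mathcal H^{I_2}\otimes\mathcal H^{O_2}$ with $\mathrm{Tr}\,W=d_{O_1}d_{O_2}$ (PAR) a parallel process if $W={}_{O_1O_2}W$; (SEQ) a sequential process (slot 1 before slot 2) if $W={}_{O_2}W$ and ${}_{I_2O_2}W={}_{O_1I_2O_2}W$; (SEP) a separable process if $W=qW^{1\prec2}+(1-q)W^{2\prec1}$ with $0\le q\le1$, $W^{1\prec 2}$ a sequential process and $W^{2\prec1}$ a sequential process with the roles of slots 1 and 2 exchanged; (GEN) a general process if ${}_{I_1O_1}W={}_{I_1O_1O_2}W$, ${}_{I_2O_2}W={}_{O_1I_2O_2}W$ and $W={}_{O_1}W+{}_{O_2}W-{}_{O_1O_2}W$. A tester with strategy $\mathcal S\in\{\mathrm{PAR},\mathrm{SEQ},\mathrm{SEP},\mathrm{GEN}\}$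 is a family $\{T_i\}_{i=1}^N$ of positive semidefinite operators whose sum is a process of kind $\mathcal S$. For an ensemble $\{p_i,\widetilde C_i\}_{i=1}^N$ of quantum channels with Choi operators $C_i=\sum_{j,k}|j\rangle\langle k|\otimes\widetilde C_i(|j\rangle\langle k|)$, the maximal probability of successful discrimination with two copies is $$P^{\mathcal S}:=\max_{\{T_i\}}\sum_{i=1}^N p_i\,\mathrm{Tr}\bigl(T_i\,C_i^{\otimes2}\bigr),$$ the maximum being over all testers with strategy $\mathcal S$. Theorem. There is an ensemble of $N=2$ qubit-to-qubit channels for which all four maxima exist and $$P^{\mathrm{PAR}}<P^{\mathrm{SEQ}}<P^{\mathrm{SEP}}<P^{\mathrm{GEN}}.$$ More precisely, this holds for $p_1=p_2=\tfrac12$, $\widetilde C_1(\rho)=K_0\rho K_0^\dagger+K_1\rho K_1^\dagger$ the amplitude-damping channel with $K_0=|0\rangle\langle0|+\sqrt{1-\gamma}\,|1\rangle\langle1|$, $K_1=\sqrt\gamma\,|0\rangle\langle1|$, $\gamma=\tfrac{67}{100}$, and $\widetilde C_2(\rho)=\eta\rho+(1-\eta)\sigma_x\rho\sigma_x$ the bit-flip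 channel with $\eta=\tfrac{87}{100}$; for this ensemble $$\tfrac{8346}{10000}<P^{\mathrm{PAR}}<\tfrac{8347}{10000},\quad \tfrac{8446}{10000}<P^{\mathrm{SEQ}}<\tfrac{8447}{10000},\quad \tfrac{8486}{10000}<P^{\mathrm{SEP}}<\tfrac{8487}{10000},\quad \tfrac{8514}{10000}<P^{\mathrm{GEN}}<\tfrac{8515}{10000}.$$ -/

import Mathlib

open scoped Matrix Kronecker ComplexOrder

noncomputable section

namespace ChannelDiscrimination

/-! ### Quantum channels -/

section Channels

variable {I O : Type} [Fintype I] [DecidableEq I] [Fintype O] [DecidableEq O]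

/-- The map `id_k ⊗ Φ`, which applies `Φ` to each block of a `k × k` block matrix. -/
def ampliation (Φ : Matrix I I ℂ →ₗ[ℂ] Matrix O O ℂ) (k : ℕ)
    (M : Matrix (Fin k × I) (Fin k × I) ℂ) : Matrix (Fin k × O) (Fin k × O) ℂ :=
  Matrix.of fun x y => Φ (Matrix.of fun i j => M (x.1, i) (y.1, j)) x.2 y.2

/-- Complete positivity: every ampliation `id_k ⊗ Φ` preserves positive semidefiniteness. -/
def IsCompletelyPositive (Φ : Matrix I I ℂ →ₗ[ℂ] Matrix O O ℂ) : Prop :=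
  ∀ (k : ℕ) (M : Matrix (Fin k × I) (Fin k × I) ℂ),
    M.PosSemidef → (ampliation Φ k M).PosSemidef

/-- Trace preservation. -/
def IsTracePreserving (Φ : Matrix I I ℂ →ₗ[ℂ] Matrix O O ℂ) : Prop :=
  ∀ ρ : Matrix I I ℂ, (Φ ρ).trace = ρ.trace

/-- A quantum channel: a completely positive trace-preserving linear map. -/
def IsQuantumChannel (Φ : Matrix I I ℂ →ₗ[ℂ] Matrix O O ℂ) : Prop :=
  IsCompletelyPositive Φ ∧ IsTracePreserving Φ

/-- The Choi operator `∑ i j, |i⟩⟨j| ⊗ Φ(|i⟩⟨j|)` on `H^I ⊗ H^O`. -/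
def choi (Φ : Matrix I I ℂ →ₗ[ℂ] Matrix O O ℂ) : Matrix (I × O) (I × O) ℂ :=
  Matrix.of fun x y => Φ (Matrix.single x.1 y.1 1) x.2 y.2

end Channels

/-- The completely positive map `ρ ↦ K ρ K†`. -/
def conjMap {I O : Type} [Fintype I] (K : Matrix O I ℂ) :
    Matrix I I ℂ →ₗ[ℂ] Matrix O O ℂ where
  toFun ρ := K * ρ * Kᴴ
  map_add' ρ σ := by rw [Matrix.mul_add, Matrix.add_mul]
  map_smul' c ρ := by simp

/-- The qubit amplitude-damping channel with damping parameter `γ`, with Kraus operators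
`|0⟩⟨0| + √(1-γ) |1⟩⟨1|` and `√γ |0⟩⟨1|`. -/
def amplitudeDamping (γ : ℝ) : Matrix (Fin 2) (Fin 2) ℂ →ₗ[ℂ] Matrix (Fin 2) (Fin 2) ℂ :=
  conjMap !![1, 0; 0, (Real.sqrt (1 - γ) : ℂ)] + conjMap !![0, (Real.sqrt γ : ℂ); 0, 0]

/-- The qubit bit-flip channel `ρ ↦ η ρ + (1-η) σₓ ρ σₓ`. -/
def bitFlip (η : ℝ) : Matrix (Fin 2) (Fin 2) ℂ →ₗ[ℂ] Matrix (Fin 2) (Fin 2) ℂ :=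
  (η : ℂ) • LinearMap.id + ((1 - η : ℝ) : ℂ) • conjMap !![0, 1; 1, 0]

/-! ### Processes and testers

Operators on `H^{I₁} ⊗ H^{O₁} ⊗ H^{I₂} ⊗ H^{O₂}` are matrices indexed by `(I × O) × (I × O)`,
the first factor being slot 1 and the second being slot 2. -/

section Testers

variable {I O : Type} [Fintype I] [DecidableEq I] [Fintype O] [DecidableEq O]

/-- Operators on the four systems `I₁ O₁ I₂ O₂`. -/
abbrev TwoSlot (I O : Type) := Matrix ((I × O) × (I × O)) ((I × O) × (I × O)) ℂ

/-- Trace-and-replace on `I₁`: `Tr_{I₁} W ⊗ 𝟙 / d_{I₁}`. -/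
def replaceI₁ (W : TwoSlot I O) : TwoSlot I O :=
  Matrix.of fun x y => if x.1.1 = y.1.1 then
    (∑ i : I, W ((i, x.1.2), x.2) ((i, y.1.2), y.2)) / (Fintype.card I : ℂ) else 0

/-- Trace-and-replace on `O₁`: `Tr_{O₁} W ⊗ 𝟙 / d_{O₁}`. -/
def replaceO₁ (W : TwoSlot I O) : TwoSlot I O :=
  Matrix.of fun x y => if x.1.2 = y.1.2 then
    (∑ o : O, W ((x.1.1, o), x.2) ((y.1.1, o), y.2)) / (Fintype.card O : ℂ) else 0

/-- Trace-and-replace on `I₂`: `Tr_{I₂} W ⊗ 𝟙 / d_{I₂}`. -/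
def replaceI₂ (W : TwoSlot I O) : TwoSlot I O :=
  Matrix.of fun x y => if x.2.1 = y.2.1 then
    (∑ i : I, W (x.1, (i, x.2.2)) (y.1, (i, y.2.2))) / (Fintype.card I : ℂ) else 0

/-- Trace-and-replace on `O₂`: `Tr_{O₂} W ⊗ 𝟙 / d_{O₂}`. -/
def replaceO₂ (W : TwoSlot I O) : TwoSlot I O :=
  Matrix.of fun x y => if x.2.2 = y.2.2 then
    (∑ o : O, W (x.1, (x.2.1, o)) (y.1, (y.2.1, o))) / (Fintype.card O : ℂ) else 0

/-- Positive operators with the trace `d_{O₁} d_{O₂}` common to all processes. -/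
def IsNormalizedPositive (W : TwoSlot I O) : Prop :=
  W.PosSemidef ∧ W.trace = (Fintype.card O : ℂ) * (Fintype.card O : ℂ)

/-- Parallel processes: `W = _{O₁O₂}W`. -/
def IsParallelProcess (W : TwoSlot I O) : Prop :=
  IsNormalizedPositive W ∧ W = replaceO₁ (replaceO₂ W)

/-- Sequential processes with slot 1 before slot 2:
`W = _{O₂}W` and `_{I₂O₂}W = _{O₁I₂O₂}W`. -/
def IsSequentialProcess (W : TwoSlot I O) : Prop :=
  IsNormalizedPositive W ∧ W = replaceO₂ W ∧
    replaceI₂ (replaceO₂ W) = replaceO₁ (replaceI₂ (replaceO₂ W))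

/-- Sequential processes with slot 2 before slot 1:
`W = _{O₁}W` and `_{I₁O₁}W = _{I₁O₁O₂}W`. -/
def IsReverseSequentialProcess (W : TwoSlot I O) : Prop :=
  IsNormalizedPositive W ∧ W = replaceO₁ W ∧
    replaceI₁ (replaceO₁ W) = replaceI₁ (replaceO₁ (replaceO₂ W))

/-- Separable processes: convex mixtures of sequential processes of the two orders. -/
def IsSeparableProcess (W : TwoSlot I O) : Prop :=
  ∃ (q : ℝ) (W₁₂ W₂₁ : TwoSlot I O), 0 ≤ q ∧ q ≤ 1 ∧
    IsSequentialProcess W₁₂ ∧ IsReverseSequentialProcess W₂₁ ∧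
    W = (q : ℂ) • W₁₂ + ((1 - q : ℝ) : ℂ) • W₂₁

/-- General processes: `_{I₁O₁}W = _{I₁O₁O₂}W`, `_{I₂O₂}W = _{O₁I₂O₂}W` and
`W = _{O₁}W + _{O₂}W - _{O₁O₂}W`. -/
def IsGeneralProcess (W : TwoSlot I O) : Prop :=
  IsNormalizedPositive W ∧
    replaceI₁ (replaceO₁ W) = replaceI₁ (replaceO₁ (replaceO₂ W)) ∧
    replaceI₂ (replaceO₂ W) = replaceO₁ (replaceI₂ (replaceO₂ W)) ∧
    W = replaceO₁ W + replaceO₂ W - replaceO₁ (replaceO₂ W)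

/-- The four kinds of strategies: parallel, sequential, separable, general. -/
inductive Strategy where
  | par
  | seq
  | sep
  | gen

/-- The processes that belong to a strategy. -/
def IsProcess : Strategy → TwoSlot I O → Prop
  | .par => IsParallelProcess
  | .seq => IsSequentialProcess
  | .sep => IsSeparableProcess
  | .gen => IsGeneralProcess

/-- A tester with strategy `S`: positive semidefinite operators that sum to a process. -/
def IsTester (S : Strategy) {N : ℕ} (T : Fin N → TwoSlot I O) : Prop :=
  (∀ i, (T i).PosSemidef) ∧ IsProcess S (∑ i, T i)

end Testers

/-! ### Discrimination of channel ensembles -/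

/-- An ensemble of `N` quantum channels, each with its probability. -/
structure ChannelEnsemble (I O : Type) [Fintype I] [DecidableEq I] [Fintype O] [DecidableEq O]
    (N : ℕ) where
  prob : Fin N → ℝ
  prob_nonneg : ∀ i, 0 ≤ prob i
  prob_sum : ∑ i, prob i = 1
  channel : Fin N → (Matrix I I ℂ →ₗ[ℂ] Matrix O O ℂ)
  isQuantumChannel : ∀ i, IsQuantumChannel (channel i)

section Success

variable {I O : Type} [Fintype I] [DecidableEq I] [Fintype O] [DecidableEq O] {N : ℕ}

/-- The success probability `∑ i, p_i Tr(T_i (C_i ⊗ C_i))` of a tester on two copies, where `C_i`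
is the Choi operator of the `i`-th channel. For a tester each trace is a real number. -/
def ChannelEnsemble.success (E : ChannelEnsemble I O N) (T : Fin N → TwoSlot I O) : ℝ :=
  ∑ i, E.prob i * (T i * (choi (E.channel i) ⊗ₖ choi (E.channel i))).trace.re

/-- The success probabilities attained by the testers with strategy `S`. -/
def ChannelEnsemble.successSet (E : ChannelEnsemble I O N) (S : Strategy) : Set ℝ :=
  {x | ∃ T : Fin N → TwoSlot I O, IsTester S T ∧ x = E.success T}

/-- The maximal probability of success with strategy `S`. -/
def ChannelEnsemble.maxSuccess (E : ChannelEnsemble I O N) (S : Strategy) : ℝ :=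
  sSup (E.successSet S)

end Success

end ChannelDiscrimination

end

noncomputable section

namespace ChannelDiscrimination

open Matrix

/-! ### Positive semidefinite matrices -/

/-! Each of the four maxima is the value of a semidefinite programme, and each is enclosed between
an explicit feasible point and an explicit dual bound. The enclosures are disjoint, which gives the
strict hierarchy.

Lower bounds come from rational testers. Upper bounds come from weak duality
(`ChannelEnsemble.success_le`): if `M` dominates every `p_i C_i ⊗ C_i`, then the success of a tester
with sum `W` is at most `Tr (W M)`. Since the trace-and-replace maps are self-adjoint, the linear
conditions on `W` turn into conditions on `M` under which `Tr (W M)` takes the same value for all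
processes of the kind (the four `trace_mul` lemmas). For separable processes `M` is instead
majorized by one such operator for each order (`IsSeparableProcess.re_trace_mul_le`). The maxima are
attained because testers form a compact set.

What remains is a finite check over the integers. Both Choi operators preserve the parity `i + o` of
a slot, so the certificates can be chosen with the same symmetry, and each `16 × 16` matrix splits
into four `4 × 4` blocks whose definiteness is decided by division-free Schur complements. The only
irrational number left in two copies of the channels is `√(1 - γ)`. It enters affinely, because its
square is rational, so a check at two rational endpoints around it suffices (`Dominates.posSemidef`,
`lt_success_of_lt_scaledSuccess`). -/

theorem trace_mul_nonneg {n : Type*} [Fintype n] {A B : Matrix n n ℂ}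
    (hA : A.PosSemidef) (hB : B.PosSemidef) : 0 ≤ (A * B).trace := by
  classical
  obtain ⟨m, v, rfl⟩ := Matrix.posSemidef_iff_eq_sum_vecMulVec.mp hA
  rw [Finset.sum_mul, Matrix.trace_sum]
  refine Finset.sum_nonneg fun i _ => ?_
  rw [Matrix.vecMulVec_mul, Matrix.trace_vecMulVec, dotProduct_comm, ← dotProduct_mulVec]
  exact hB.dotProduct_mulVec_nonneg _

theorem posSemidef_blockDiagonal {m o : Type*} [Fintype m] [DecidableEq m] [Fintype o]
    [DecidableEq o] {M : o → Matrix m m ℂ} (h : ∀ k, (M k).PosSemidef) :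
    (blockDiagonal M).PosSemidef := by
  have hr : ∀ k, ∃ B : Matrix m m ℂ, M k = Bᴴ * B := fun k =>
    ⟨_, (by
      open scoped MatrixOrder in
      exact (CStarAlgebra.nonneg_iff_eq_star_mul_self.mp (h k).nonneg).choose_spec)⟩
  choose B hB using hr
  have : blockDiagonal M = (blockDiagonal B)ᴴ * blockDiagonal B := by
    rw [blockDiagonal_conjTranspose, ← blockDiagonal_mul]
    exact congrArg _ (funext hB)
  rw [this]
  exact posSemidef_conjTranspose_mul_self _

/-- A matrix with positive corner is positive semidefinite if its Schur complement is. -/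
theorem posSemidef_of_schur {n : ℕ} {A : Matrix (Fin (n + 1)) (Fin (n + 1)) ℂ}
    (hA : A.IsHermitian) (h0 : 0 < A 0 0)
    (hS : (Matrix.of fun i j : Fin n =>
      A 0 0 * A i.succ j.succ - A i.succ 0 * A 0 j.succ).PosSemidef) : A.PosSemidef := by
  -- One step of Cholesky elimination: `A 0 0 • A` is the rank-one square of the first column plus
  -- the Schur complement padded by a zero row and column. The complement is scaled by the pivot, so
  -- integer entries stay integers.
  have key : A = (A 0 0)⁻¹ • (vecMulVec (fun i => A i 0) (star fun i => A i 0) +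
      (Matrix.of fun (i : Fin n) (j : Fin (n + 1)) => if j = i.succ then (1 : ℂ) else 0)ᴴ *
        (Matrix.of fun i j : Fin n =>
          A 0 0 * A i.succ j.succ - A i.succ 0 * A 0 j.succ) *
        Matrix.of fun (i : Fin n) (j : Fin (n + 1)) => if j = i.succ then (1 : ℂ) else 0) := by
    ext i j
    rw [Matrix.smul_apply, smul_eq_mul, eq_inv_mul_iff_mul_eq₀ h0.ne', Matrix.add_apply]
    simp only [Matrix.mul_apply, vecMulVec_apply, Pi.star_apply, conjTranspose_apply, of_apply,
      hA.apply]
    refine Fin.cases ?_ (fun i => ?_) i <;> refine Fin.cases ?_ (fun j => ?_) j <;>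
      simp [Fin.succ_ne_zero, eq_comm, apply_ite] <;> ring
  rw [key]
  exact ((posSemidef_vecMulVec_self_star _).add (hS.conjTranspose_mul_mul_same _)).smul
    (by simpa using h0.le)

/-- Positive definiteness of an integer matrix, tested by iterated Schur complements. -/
def IsSchurPositive : (n : ℕ) → Matrix (Fin n) (Fin n) ℤ → Prop
  | 0, _ => True
  | n + 1, A => (0 < A 0 0 ∧ ∀ i : Fin n, A 0 i.succ = A i.succ 0) ∧
      IsSchurPositive n (Matrix.of fun i j =>
        A 0 0 * A i.succ j.succ - A i.succ 0 * A 0 j.succ)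

instance decidableIsSchurPositive : (n : ℕ) → (A : Matrix (Fin n) (Fin n) ℤ) →
    Decidable (IsSchurPositive n A)
  | 0, _ => isTrue trivial
  | n + 1, _ => @instDecidableAnd _ _ _ (decidableIsSchurPositive n _)

theorem IsSchurPositive.posSemidef {n : ℕ} {A : Matrix (Fin n) (Fin n) ℤ}
    (h : IsSchurPositive n A) : (A.map (Int.cast : ℤ → ℂ)).PosSemidef := by
  induction n with
  | zero =>
    have : A.map (Int.cast : ℤ → ℂ) = 0 := Subsingleton.elim _ _
    rw [this]; exact .zero
  | succ n ih =>
    obtain ⟨⟨h0, hs⟩, hS⟩ := h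
    have hP := ih hS
    have h0' : (0 : ℂ) < (A 0 0 : ℂ) := by exact_mod_cast h0
    -- `IsSchurPositive` compares only the first row with the first column. Symmetry of the
    -- remaining block follows from that of the Schur complement, since the subtracted product is
    -- symmetric and the pivot is nonzero.
    have hSs : ∀ i j : Fin n, A i.succ j.succ = A j.succ i.succ := fun i j => by
      have e := hP.1.apply i j
      simp only [map_apply, of_apply, Int.cast_sub, Int.cast_mul, star_sub, star_mul', star_intCast]
        at e
      have e' : A 0 0 * A j.succ i.succ - A j.succ 0 * A 0 i.succ =
        A 0 0 * A i.succ j.succ - A i.succ 0 * A 0 j.succ := by exact_mod_cast e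
      rw [hs, hs] at e'
      exact mul_left_cancel₀ h0.ne' (by linarith)
    refine posSemidef_of_schur ?_ h0' ?_
    · ext i j
      simp only [conjTranspose_apply, map_apply, star_intCast, Int.cast_inj]
      refine Fin.cases ?_ (fun i => ?_) i <;> refine Fin.cases ?_ (fun j => ?_) j
      · rfl
      · exact (hs j).symm
      · exact hs i
      · exact hSs j i
    · convert hP using 1
      ext i j
      simp

/-! ### Trace-and-replace maps are self-adjoint -/

set_option linter.unusedSectionVars false

section Adjoint

/-- The equivalence `e` separates the kept factor `A` from the replaced factor `B`. Both sides equal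
`Tr (Tr_B W · Tr_B M) / c`, which is symmetric in `W` and `M`. -/
theorem trace_replace_mul {n A B : Type*} [Fintype n] [Fintype A] [Fintype B] [DecidableEq B]
    (e : n ≃ A × B) (c : ℂ) {W M W' M' : Matrix n n ℂ}
    (hW : ∀ x y, W' x y = if (e x).2 = (e y).2 then
      (∑ b, W (e.symm ((e x).1, b)) (e.symm ((e y).1, b))) / c else 0)
    (hM : ∀ x y, M' x y = if (e x).2 = (e y).2 then
      (∑ b, M (e.symm ((e x).1, b)) (e.symm ((e y).1, b))) / c else 0) :
    (W' * M).trace = (W * M').trace := by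
  simp only [Matrix.trace, Matrix.diag, Matrix.mul_apply, hW, hM]
  rw [← e.symm.sum_comp, ← e.symm.sum_comp]
  simp_rw [← e.symm.sum_comp (fun y => _ * _), Equiv.apply_symm_apply, Fintype.sum_prod_type,
    ite_mul, mul_ite, zero_mul, mul_zero, Finset.sum_ite_eq, Finset.mem_univ, if_true]
  refine Finset.sum_congr rfl fun a _ => ?_
  rw [Finset.sum_comm, Finset.sum_comm (s := (Finset.univ : Finset B))]
  refine Finset.sum_congr rfl fun a' _ => ?_
  simp only [Finset.sum_ite_eq', Finset.mem_univ, if_true]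
  rw [← Finset.mul_sum, ← Finset.sum_mul]
  ring

variable {I O : Type} [Fintype I] [DecidableEq I] [Fintype O] [DecidableEq O]

theorem trace_replaceI₁_mul (W M : TwoSlot I O) :
    (replaceI₁ W * M).trace = (W * replaceI₁ M).trace :=
  trace_replace_mul (A := O × (I × O)) (B := I)
    ⟨fun x => ((x.1.2, x.2), x.1.1), fun y => ((y.2, y.1.1), y.1.2), fun _ => rfl, fun _ => rfl⟩
    _ (fun _ _ => rfl) (fun _ _ => rfl)

theorem trace_replaceO₁_mul (W M : TwoSlot I O) :
    (replaceO₁ W * M).trace = (W * replaceO₁ M).trace :=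
  trace_replace_mul (A := I × (I × O)) (B := O)
    ⟨fun x => ((x.1.1, x.2), x.1.2), fun y => ((y.1.1, y.2), y.1.2), fun _ => rfl, fun _ => rfl⟩
    _ (fun _ _ => rfl) (fun _ _ => rfl)

theorem trace_replaceI₂_mul (W M : TwoSlot I O) :
    (replaceI₂ W * M).trace = (W * replaceI₂ M).trace :=
  trace_replace_mul (A := (I × O) × O) (B := I)
    ⟨fun x => ((x.1, x.2.2), x.2.1), fun y => (y.1.1, (y.2, y.1.2)), fun _ => rfl, fun _ => rfl⟩
    _ (fun _ _ => rfl) (fun _ _ => rfl)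

theorem trace_replaceO₂_mul (W M : TwoSlot I O) :
    (replaceO₂ W * M).trace = (W * replaceO₂ M).trace :=
  trace_replace_mul (A := (I × O) × I) (B := O)
    ⟨fun x => ((x.1, x.2.1), x.2.2), fun y => (y.1.1, (y.1.2, y.2)), fun _ => rfl, fun _ => rfl⟩
    _ (fun _ _ => rfl) (fun _ _ => rfl)

/-! ### Operators with a constant pairing with all processes of a kind -/

theorem IsParallelProcess.trace_mul {W M : TwoSlot I O} {c : ℂ} (hW : IsParallelProcess W)
    (hM : replaceO₂ (replaceO₁ M) = c • 1) :
    (W * M).trace = c * (Fintype.card O * Fintype.card O) := by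
  rw [hW.2, trace_replaceO₁_mul, trace_replaceO₂_mul, hM, mul_smul_comm, mul_one, trace_smul,
    hW.1.2, smul_eq_mul]

/-- After `O₂` has moved onto `M`, `h1` allows `I₂` to be inserted. Moved back to `W`, the pair `I₂
O₂` triggers the second process condition, which supplies `O₁`; `h2` then leaves only the trace of
`W`. -/
theorem IsSequentialProcess.trace_mul {W M : TwoSlot I O} {c : ℂ} (hW : IsSequentialProcess W)
    (h1 : replaceO₂ M = replaceO₂ (replaceI₂ M))
    (h2 : replaceO₂ (replaceI₂ (replaceO₁ M)) = c • 1) :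
    (W * M).trace = c * (Fintype.card O * Fintype.card O) := by
  rw [hW.2.1, trace_replaceO₂_mul, h1, ← trace_replaceO₂_mul, ← trace_replaceI₂_mul, hW.2.2,
    trace_replaceO₁_mul, trace_replaceI₂_mul, trace_replaceO₂_mul, h2, mul_smul_comm, mul_one,
    trace_smul, hW.1.2, smul_eq_mul]

theorem IsReverseSequentialProcess.trace_mul {W M : TwoSlot I O} {c : ℂ}
    (hW : IsReverseSequentialProcess W)
    (h1 : replaceO₁ M = replaceO₁ (replaceI₁ M))
    (h2 : replaceO₂ (replaceO₁ (replaceI₁ M)) = c • 1) :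
    (W * M).trace = c * (Fintype.card O * Fintype.card O) := by
  rw [hW.2.1, trace_replaceO₁_mul, h1, ← trace_replaceO₁_mul, ← trace_replaceI₁_mul, hW.2.2,
    trace_replaceI₁_mul, trace_replaceO₁_mul, trace_replaceO₂_mul, h2, mul_smul_comm, mul_one,
    trace_smul, hW.1.2, smul_eq_mul]

/-- The operator in `hM` is the adjoint of the projection onto the span of general processes,
applied to `M`: the first three terms come from the third process condition, and the other two pairs
have zero pairing with `W` by the first two conditions. -/
theorem IsGeneralProcess.trace_mul {W M : TwoSlot I O} {c : ℂ} (hW : IsGeneralProcess W)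
    (hM : replaceO₁ M + replaceO₂ M - replaceO₂ (replaceO₁ M)
      - replaceO₁ (replaceI₁ M) + replaceO₂ (replaceO₁ (replaceI₁ M))
      - replaceO₂ (replaceI₂ M) + replaceO₂ (replaceI₂ (replaceO₁ M)) = c • 1) :
    (W * M).trace = c * (Fintype.card O * Fintype.card O) := by
  obtain ⟨⟨-, ht⟩, h1, h2, h3⟩ := hW
  have e1 := congrArg (fun X => (X * M).trace) h1
  have e2 := congrArg (fun X => (X * M).trace) h2
  have e3 := congrArg (fun X => (X * M).trace) h3
  have e4 := congrArg (fun X => (W * X).trace) hM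
  simp only [add_mul, sub_mul, mul_add, mul_sub, trace_add, trace_sub, trace_replaceO₁_mul,
    trace_replaceO₂_mul, trace_replaceI₁_mul, trace_replaceI₂_mul, mul_smul_comm, mul_one,
    trace_smul, ht, smul_eq_mul] at e1 e2 e3 e4
  linear_combination e3 + e4 + e1 + e2

/-- `M` itself needs no constant pairing. On each ordered component its pairing is at most that of
the majorant for that order, and the bound `l` survives convex mixing. -/
theorem IsSeparableProcess.re_trace_mul_le {W M M₁₂ M₂₁ : TwoSlot I O} {l : ℝ}
    (hW : IsSeparableProcess W)
    (h12 : (M₁₂ - M).PosSemidef) (h21 : (M₂₁ - M).PosSemidef)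
    (hl12 : ∀ V : TwoSlot I O, IsSequentialProcess V → (V * M₁₂).trace.re ≤ l)
    (hl21 : ∀ V : TwoSlot I O, IsReverseSequentialProcess V → (V * M₂₁).trace.re ≤ l) :
    (W * M).trace.re ≤ l := by
  obtain ⟨q, V, V', hq0, hq1, hV, hV', rfl⟩ := hW
  have a1 := (Complex.le_def.1 (trace_mul_nonneg hV.1.1 h12)).1
  have a2 := (Complex.le_def.1 (trace_mul_nonneg hV'.1.1 h21)).1
  have b1 := hl12 V hV
  have b2 := hl21 V' hV'
  simp only [mul_sub, trace_sub, Complex.sub_re, Complex.zero_re] at a1 a2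
  rw [add_mul, trace_add, smul_mul_assoc, smul_mul_assoc, trace_smul, trace_smul, smul_eq_mul,
    smul_eq_mul, Complex.add_re, Complex.re_ofReal_mul, Complex.re_ofReal_mul]
  nlinarith

/-! ### Weak duality -/

variable {N : ℕ}

/-- Each `T i` pairs nonnegatively with the slack `M - p_i C_i ⊗ C_i`; summing over `i` leaves the
pairing of `M` with the process. -/
theorem ChannelEnsemble.success_le (E : ChannelEnsemble I O N) {S : Strategy} {M : TwoSlot I O}
    {l : ℝ}
    (hM : ∀ i, (M - (E.prob i : ℂ) • (choi (E.channel i) ⊗ₖ choi (E.channel i))).PosSemidef)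
    (hl : ∀ W : TwoSlot I O, IsProcess S W → (W * M).trace.re ≤ l)
    {T : Fin N → TwoSlot I O} (hT : IsTester S T) : E.success T ≤ l := by
  refine le_trans ?_ (hl _ hT.2)
  rw [Finset.sum_mul, trace_sum, Complex.re_sum]
  refine Finset.sum_le_sum fun i _ => ?_
  have h := (Complex.le_def.1 (trace_mul_nonneg (hT.1 i) (hM i))).1
  rw [mul_sub, trace_sub, mul_smul_comm, trace_smul, smul_eq_mul, Complex.sub_re,
    Complex.re_ofReal_mul, Complex.zero_re] at h
  linarith

/-! ### Existence of the maxima -/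

theorem isClosed_posSemidef (n : Type*) [Fintype n] :
    IsClosed {A : Matrix n n ℂ | A.PosSemidef} := by
  simp only [Matrix.posSemidef_iff_dotProduct_mulVec, Matrix.IsHermitian, Set.ofPred_and,
    Set.ofPred_forall]
  refine (isClosed_eq (by fun_prop) (by fun_prop)).inter (isClosed_iInter fun x => ?_)
  exact isClosed_le (by fun_prop) (by fun_prop)

theorem continuous_replaceI₁ : Continuous (replaceI₁ : TwoSlot I O → TwoSlot I O) := by
  refine continuous_matrix fun x y => ?_
  simp only [replaceI₁, of_apply]
  split_ifs <;> fun_prop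

theorem continuous_replaceO₁ : Continuous (replaceO₁ : TwoSlot I O → TwoSlot I O) := by
  refine continuous_matrix fun x y => ?_
  simp only [replaceO₁, of_apply]
  split_ifs <;> fun_prop

theorem continuous_replaceI₂ : Continuous (replaceI₂ : TwoSlot I O → TwoSlot I O) := by
  refine continuous_matrix fun x y => ?_
  simp only [replaceI₂, of_apply]
  split_ifs <;> fun_prop

theorem continuous_replaceO₂ : Continuous (replaceO₂ : TwoSlot I O → TwoSlot I O) := by
  refine continuous_matrix fun x y => ?_
  simp only [replaceO₂, of_apply]
  split_ifs <;> fun_prop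

/-- The principal minor on `i, j` gives `|A i j|² ≤ A i i * A j j`, and each diagonal entry is at
most the trace. With the fixed trace of processes this yields boundedness. -/
theorem norm_apply_le_of_posSemidef {n : Type*} [Fintype n] {A : Matrix n n ℂ}
    (hA : A.PosSemidef) (i j : n) : ‖A i j‖ ≤ A.trace.re := by
  classical
  have hd : ∀ k, A k k = ((A k k).re : ℂ) := fun k =>
    Complex.ext rfl (Complex.le_def.1 (hA.diag_nonneg (i := k))).2.symm
  have hd0 : ∀ k, 0 ≤ (A k k).re := fun k => (Complex.le_def.1 (hA.diag_nonneg (i := k))).1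
  have htr : ∀ k, (A k k).re ≤ A.trace.re := fun k => by
    rw [Matrix.trace, Complex.re_sum]
    exact Finset.single_le_sum (f := fun k => (A.diag k).re) (fun k _ => hd0 k)
      (Finset.mem_univ k)
  have h2 := (Complex.le_def.1 (hA.submatrix ![i, j]).det_nonneg).1
  have hji : A j i = star (A i j) := (hA.1.apply j i).symm
  simp only [det_fin_two, submatrix_apply, cons_val_zero, cons_val_one] at h2
  rw [hji, Complex.star_def, Complex.mul_conj, hd i, hd j, ← Complex.ofReal_mul,
    ← Complex.ofReal_sub, Complex.ofReal_re, Complex.zero_re, Complex.normSq_eq_norm_sq] at h2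
  have := htr i
  have := htr j
  have := hd0 i
  have := hd0 j
  refine abs_le_of_sq_le_sq' ?_ (by linarith) |>.2
  nlinarith

theorem isCompact_of_isClosed_of_isNormalizedPositive {s : Set (TwoSlot I O)} (hc : IsClosed s)
    (h : ∀ W ∈ s, IsNormalizedPositive W) : IsCompact s := by
  refine IsCompact.of_isClosed_subset (s := Set.pi Set.univ fun _ => Set.pi Set.univ fun _ =>
    Metric.closedBall 0 ((Fintype.card O : ℝ) * Fintype.card O)) ?_ hc ?_
  · exact isCompact_univ_pi fun _ => isCompact_univ_pi fun _ => isCompact_closedBall _ _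
  · intro W hW i _ j _
    rw [mem_closedBall_zero_iff]
    refine (norm_apply_le_of_posSemidef (h W hW).1 i j).trans_eq ?_
    rw [(h W hW).2]
    norm_cast

theorem isClosed_isNormalizedPositive : IsClosed {W : TwoSlot I O | IsNormalizedPositive W} :=
  (isClosed_posSemidef _).inter (isClosed_eq (by fun_prop) continuous_const)

theorem isCompact_isSequentialProcess : IsCompact {W : TwoSlot I O | IsSequentialProcess W} :=
  isCompact_of_isClosed_of_isNormalizedPositive
    (isClosed_isNormalizedPositive.inter ((isClosed_eq continuous_id continuous_replaceO₂).inter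
      (isClosed_eq (continuous_replaceI₂.comp continuous_replaceO₂)
        (continuous_replaceO₁.comp (continuous_replaceI₂.comp continuous_replaceO₂)))))
    fun _ h => h.1

theorem isCompact_isReverseSequentialProcess :
    IsCompact {W : TwoSlot I O | IsReverseSequentialProcess W} :=
  isCompact_of_isClosed_of_isNormalizedPositive
    (isClosed_isNormalizedPositive.inter ((isClosed_eq continuous_id continuous_replaceO₁).inter
      (isClosed_eq (continuous_replaceI₁.comp continuous_replaceO₁)
        (continuous_replaceI₁.comp (continuous_replaceO₁.comp continuous_replaceO₂)))))
    fun _ h => h.1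

/-- Closedness is not visible from the existential definition; the set is the continuous image of
`[0, 1]` times the two compact sets of ordered processes. -/
theorem isCompact_isSeparableProcess : IsCompact {W : TwoSlot I O | IsSeparableProcess W} := by
  have h := ((isCompact_Icc (a := (0 : ℝ)) (b := 1)).prod
    ((isCompact_isSequentialProcess (I := I) (O := O)).prod
      isCompact_isReverseSequentialProcess)).image
    (f := fun p => (p.1 : ℂ) • p.2.1 + ((1 - p.1 : ℝ) : ℂ) • p.2.2) (by fun_prop)
  convert h using 1
  ext W
  constructor
  · rintro ⟨q, V, V', h0, h1, hV, hV', rfl⟩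
    exact ⟨(q, V, V'), ⟨⟨h0, h1⟩, hV, hV'⟩, rfl⟩
  · rintro ⟨⟨q, V, V'⟩, ⟨⟨h0, h1⟩, hV, hV'⟩, rfl⟩
    exact ⟨q, V, V', h0, h1, hV, hV', rfl⟩

theorem isCompact_isProcess (S : Strategy) : IsCompact {W : TwoSlot I O | IsProcess S W} := by
  cases S with
  | par =>
    exact isCompact_of_isClosed_of_isNormalizedPositive
      (isClosed_isNormalizedPositive.inter
        (isClosed_eq continuous_id (continuous_replaceO₁.comp continuous_replaceO₂)))
      fun _ h => h.1
  | seq => exact isCompact_isSequentialProcess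
  | sep => exact isCompact_isSeparableProcess
  | gen =>
    exact isCompact_of_isClosed_of_isNormalizedPositive
      (isClosed_isNormalizedPositive.inter
        ((isClosed_eq (continuous_replaceI₁.comp continuous_replaceO₁)
          (continuous_replaceI₁.comp (continuous_replaceO₁.comp continuous_replaceO₂))).inter
        ((isClosed_eq (continuous_replaceI₂.comp continuous_replaceO₂)
          (continuous_replaceO₁.comp (continuous_replaceI₂.comp continuous_replaceO₂))).inter
        (isClosed_eq continuous_id ((continuous_replaceO₁.add continuous_replaceO₂).sub
          (continuous_replaceO₁.comp continuous_replaceO₂))))))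
      fun _ h => h.1

theorem isNormalizedPositive_of_isProcess {S : Strategy} {W : TwoSlot I O}
    (h : IsProcess S W) : IsNormalizedPositive W := by
  cases S with
  | par => exact h.1
  | seq => exact h.1
  | sep =>
    obtain ⟨q, V, V', h0, h1, hV, hV', rfl⟩ := h
    refine ⟨(hV.1.1.smul (by exact_mod_cast h0)).add (hV'.1.1.smul ?_), ?_⟩
    · exact_mod_cast sub_nonneg.2 h1
    · rw [trace_add, trace_smul, trace_smul, hV.1.2, hV'.1.2, smul_eq_mul, smul_eq_mul]
      push_cast
      ring
  | gen => exact h.1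

theorem norm_apply_le_of_isTester {S : Strategy} {T : Fin N → TwoSlot I O} (hT : IsTester S T)
    (k : Fin N) (i j : (I × O) × (I × O)) :
    ‖T k i j‖ ≤ (Fintype.card O : ℝ) * Fintype.card O := by
  have htr : (∑ i, T i).trace.re = (Fintype.card O : ℝ) * Fintype.card O := by
    rw [(isNormalizedPositive_of_isProcess hT.2).2]; norm_cast
  refine (norm_apply_le_of_posSemidef (hT.1 k) i j).trans ?_
  rw [← htr, trace_sum, Complex.re_sum]
  exact Finset.single_le_sum (f := fun k => (T k).trace.re)
    (fun k _ => (Complex.le_def.1 (hT.1 k).trace_nonneg).1) (Finset.mem_univ k)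

theorem isCompact_isTester (S : Strategy) (N : ℕ) :
    IsCompact {T : Fin N → TwoSlot I O | IsTester S T} := by
  refine IsCompact.of_isClosed_subset (s := Set.pi Set.univ fun _ => Set.pi Set.univ fun _ =>
    Set.pi Set.univ fun _ => Metric.closedBall 0 ((Fintype.card O : ℝ) * Fintype.card O)) ?_ ?_ ?_
  · exact isCompact_univ_pi fun _ => isCompact_univ_pi fun _ => isCompact_univ_pi fun _ =>
      isCompact_closedBall _ _
  · have h1 : IsClosed {T : Fin N → TwoSlot I O | ∀ i, (T i).PosSemidef} := by
      simp only [Set.ofPred_forall]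
      exact isClosed_iInter fun i => 
        (isClosed_posSemidef _).preimage (f := fun T : Fin N → TwoSlot I O => T i)
          (continuous_apply i)
    exact h1.inter ((isCompact_isProcess S).isClosed.preimage
      (f := fun T : Fin N → TwoSlot I O => ∑ i, T i) (by fun_prop))
  · intro T hT k _ i _ j _
    rw [mem_closedBall_zero_iff]
    exact norm_apply_le_of_isTester hT k i j

/-- The tester `T` serves only to make the set of success probabilities nonempty. -/
theorem ChannelEnsemble.isGreatest_maxSuccess (E : ChannelEnsemble I O N) {S : Strategy}
    {T : Fin N → TwoSlot I O} (hT : IsTester S T) :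
    IsGreatest (E.successSet S) (E.maxSuccess S) := by
  have h : E.successSet S = E.success '' {T | IsTester S T} := by
    ext x
    exact ⟨fun ⟨T, hT, hx⟩ => ⟨T, hT, hx.symm⟩, fun ⟨T, hT, hx⟩ => ⟨T, hT, hx.symm⟩⟩
  refine IsCompact.isGreatest_sSup ?_ ⟨_, T, hT, rfl⟩
  rw [h]
  refine (isCompact_isTester S N).image ?_
  unfold ChannelEnsemble.success
  fun_prop

end Adjoint

/-! ### Integer operators on two qubit slots -/

/-- Integer matrices indexed by the basis of four qubits `I₁ O₁ I₂ O₂`. -/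
abbrev IntOp := Matrix ((Fin 2 × Fin 2) × (Fin 2 × Fin 2)) ((Fin 2 × Fin 2) × (Fin 2 × Fin 2)) ℤ

/-- The operator `X / D`. -/
def ofInt (D : ℕ) (X : IntOp) : TwoSlot (Fin 2) (Fin 2) :=
  (D : ℂ)⁻¹ • X.map (Int.cast : ℤ → ℂ)

theorem ofInt_apply (D : ℕ) (X : IntOp) (x y) : ofInt D X x y = (X x y : ℂ) / D := by
  simp [ofInt, div_eq_inv_mul]

/-- The partial trace over `I₁`, tensored with the identity. -/
def sumI₁ (W : IntOp) : IntOp := Matrix.of fun x y => if x.1.1 = y.1.1 then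
  W ((0, x.1.2), x.2) ((0, y.1.2), y.2) + W ((1, x.1.2), x.2) ((1, y.1.2), y.2) else 0

/-- The partial trace over `O₁`, tensored with the identity. -/
def sumO₁ (W : IntOp) : IntOp := Matrix.of fun x y => if x.1.2 = y.1.2 then
  W ((x.1.1, 0), x.2) ((y.1.1, 0), y.2) + W ((x.1.1, 1), x.2) ((y.1.1, 1), y.2) else 0

/-- The partial trace over `I₂`, tensored with the identity. -/
def sumI₂ (W : IntOp) : IntOp := Matrix.of fun x y => if x.2.1 = y.2.1 then
  W (x.1, (0, x.2.2)) (y.1, (0, y.2.2)) + W (x.1, (1, x.2.2)) (y.1, (1, y.2.2)) else 0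

/-- The partial trace over `O₂`, tensored with the identity. -/
def sumO₂ (W : IntOp) : IntOp := Matrix.of fun x y => if x.2.2 = y.2.2 then
  W (x.1, (x.2.1, 0)) (y.1, (y.2.1, 0)) + W (x.1, (x.2.1, 1)) (y.1, (y.2.1, 1)) else 0

/-- Division by the dimension is absorbed into the denominator, so numerators stay integral. This is
the origin of the factors 2 and 4 in the integer criteria below. -/
theorem replaceI₁_ofInt (D : ℕ) (X : IntOp) :
    replaceI₁ (ofInt D X) = ofInt (2 * D) (sumI₁ X) := by
  ext x y
  simp only [replaceI₁, sumI₁, of_apply, ofInt_apply, Fin.sum_univ_two, Fintype.card_fin]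
  split_ifs <;> push_cast <;> ring

theorem replaceO₁_ofInt (D : ℕ) (X : IntOp) :
    replaceO₁ (ofInt D X) = ofInt (2 * D) (sumO₁ X) := by
  ext x y
  simp only [replaceO₁, sumO₁, of_apply, ofInt_apply, Fin.sum_univ_two, Fintype.card_fin]
  split_ifs <;> push_cast <;> ring

theorem replaceI₂_ofInt (D : ℕ) (X : IntOp) :
    replaceI₂ (ofInt D X) = ofInt (2 * D) (sumI₂ X) := by
  ext x y
  simp only [replaceI₂, sumI₂, of_apply, ofInt_apply, Fin.sum_univ_two, Fintype.card_fin]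
  split_ifs <;> push_cast <;> ring

theorem replaceO₂_ofInt (D : ℕ) (X : IntOp) :
    replaceO₂ (ofInt D X) = ofInt (2 * D) (sumO₂ X) := by
  ext x y
  simp only [replaceO₂, sumO₂, of_apply, ofInt_apply, Fin.sum_univ_two, Fintype.card_fin]
  split_ifs <;> push_cast <;> ring

theorem ofInt_eq_ofInt_mul {D k : ℕ} (hk : k ≠ 0) {X Y : IntOp} (h : (k : ℤ) • X = Y) :
    ofInt D X = ofInt (k * D) Y := by
  ext x y
  have hk' : (k : ℂ) ≠ 0 := by exact_mod_cast hk
  rw [ofInt_apply, ofInt_apply, ← h, Matrix.smul_apply, smul_eq_mul]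
  push_cast
  rw [mul_div_mul_left _ _ hk']

theorem ofInt_eq_smul_one {D k : ℕ} (hk : k ≠ 0) {X : IntOp} {a : ℤ}
    (h : X = (k * a : ℤ) • (1 : IntOp)) : ofInt (k * D) X = ((a : ℂ) / D) • 1 := by
  ext x y
  have hk' : (k : ℂ) ≠ 0 := by exact_mod_cast hk
  rw [ofInt_apply, h, Matrix.smul_apply, Matrix.smul_apply, Matrix.one_apply, Matrix.one_apply,
    smul_eq_mul, smul_eq_mul]
  push_cast
  rw [mul_assoc, mul_div_mul_left _ _ hk', ← div_mul_eq_mul_div]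

/-! ### Operators that preserve the parities of the slots -/

/-- The parities `i + o` of the two slots. -/
def parity (x : (Fin 2 × Fin 2) × (Fin 2 × Fin 2)) : Fin 2 × Fin 2 :=
  (x.1.1 + x.1.2, x.2.1 + x.2.2)

/-- The index of the input pair among `00, 01, 10, 11`. -/
def position (x : (Fin 2 × Fin 2) × (Fin 2 × Fin 2)) : Fin 4 :=
  ![![0, 1], ![2, 3]] x.1.1 x.2.1

/-- The basis element with given parities and inputs. -/
def blockIndex (c : Fin 2 × Fin 2) (p : Fin 4) : (Fin 2 × Fin 2) × (Fin 2 × Fin 2) :=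
  ((![0, 0, 1, 1] p, ![0, 0, 1, 1] p + c.1), (![0, 1, 0, 1] p, ![0, 1, 0, 1] p + c.2))

/-- The decomposition of the basis according to the parities. -/
def blockEquiv : Fin 4 × (Fin 2 × Fin 2) ≃ (Fin 2 × Fin 2) × (Fin 2 × Fin 2) where
  toFun q := blockIndex q.2 q.1
  invFun x := (position x, parity x)
  left_inv := by unfold Function.LeftInverse; decide
  right_inv := by unfold Function.RightInverse Function.LeftInverse; decide

/-- The operator with the given blocks for the parities `00, 01, 10, 11`. -/
def ofBlocks (A₀₀ A₀₁ A₁₀ A₁₁ : Matrix (Fin 4) (Fin 4) ℤ) : IntOp :=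
  Matrix.of fun x y => if parity x = parity y then
    (![![A₀₀, A₀₁], ![A₁₀, A₁₁]] (parity x).1 (parity x).2) (position x) (position y) else 0

/-- The exchange of the two slots in a block. -/
def swapBlock (A : Matrix (Fin 4) (Fin 4) ℤ) : Matrix (Fin 4) (Fin 4) ℤ :=
  A.submatrix ![0, 2, 1, 3] ![0, 2, 1, 3]

/-- The exchange of the two slots. -/
def swapSlots (X : IntOp) : IntOp := X.submatrix Prod.swap Prod.swap

/-- Parity preservation together with the positive definiteness of all blocks. -/
def IsBlockPositive (X : IntOp) : Prop :=
  (X = Matrix.of fun x y => if parity x = parity y then X x y else 0) ∧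
    ∀ c, IsSchurPositive 4 (X.submatrix (blockIndex c) (blockIndex c))

instance (X : IntOp) : Decidable (IsBlockPositive X) :=
  inferInstanceAs (Decidable (_ ∧ _))

/-- Reindexing by `blockEquiv` makes a parity-preserving operator block diagonal, with one block for
each pair of parities. -/
theorem IsBlockPositive.posSemidef {X : IntOp} (h : IsBlockPositive X) (D : ℕ) :
    (ofInt D X).PosSemidef := by
  refine PosSemidef.smul ?_ (by positivity)
  rw [← posSemidef_submatrix_equiv blockEquiv]
  convert posSemidef_blockDiagonal fun c => (h.2 c).posSemidef using 1
  ext ⟨p, c⟩ ⟨q, d⟩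
  rw [blockDiagonal_apply]
  split_ifs with hcd
  · subst hcd; rfl
  · have hp : parity (blockEquiv (p, c)) ≠ parity (blockEquiv (q, d)) := by
      have key : ∀ r, parity (blockEquiv r) = r.2 := by decide
      rwa [key, key]
    rw [submatrix_apply, map_apply, h.1, of_apply, if_neg hp, Int.cast_zero]

/-! ### Integer criteria for processes -/

theorem trace_ofInt (D : ℕ) (X : IntOp) : (ofInt D X).trace = (X.trace : ℂ) / D := by
  simp [Matrix.trace, ofInt_apply, Finset.sum_div]

theorem isNormalizedPositive_ofInt {D : ℕ} (hD : D ≠ 0) {X : IntOp}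
    (h : (ofInt D X).PosSemidef) (ht : X.trace = 4 * D) : IsNormalizedPositive (ofInt D X) := by
  refine ⟨h, ?_⟩
  have hD' : (D : ℂ) ≠ 0 := by exact_mod_cast hD
  rw [trace_ofInt, ht]
  push_cast
  rw [mul_div_assoc, div_self hD']
  norm_num

theorem isParallelProcess_ofInt {D : ℕ} {X : IntOp} (hX : IsNormalizedPositive (ofInt D X))
    (h : (4 : ℤ) • X = sumO₁ (sumO₂ X)) : IsParallelProcess (ofInt D X) := by
  refine ⟨hX, ?_⟩
  rw [replaceO₂_ofInt, replaceO₁_ofInt, ← mul_assoc]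
  exact ofInt_eq_ofInt_mul (by norm_num) h

theorem isSequentialProcess_ofInt {D : ℕ} {X : IntOp} (hX : IsNormalizedPositive (ofInt D X))
    (h1 : (2 : ℤ) • X = sumO₂ X)
    (h2 : (2 : ℤ) • sumI₂ (sumO₂ X) = sumO₁ (sumI₂ (sumO₂ X))) :
    IsSequentialProcess (ofInt D X) := by
  refine ⟨hX, ?_, ?_⟩
  · rw [replaceO₂_ofInt]
    exact ofInt_eq_ofInt_mul (by norm_num) h1
  · rw [replaceO₂_ofInt, replaceI₂_ofInt, replaceO₁_ofInt]
    exact ofInt_eq_ofInt_mul (by norm_num) h2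

theorem isReverseSequentialProcess_ofInt {D : ℕ} {X : IntOp}
    (hX : IsNormalizedPositive (ofInt D X))
    (h1 : (2 : ℤ) • X = sumO₁ X)
    (h2 : (2 : ℤ) • sumI₁ (sumO₁ X) = sumI₁ (sumO₁ (sumO₂ X))) :
    IsReverseSequentialProcess (ofInt D X) := by
  refine ⟨hX, ?_, ?_⟩
  · rw [replaceO₁_ofInt]
    exact ofInt_eq_ofInt_mul (by norm_num) h1
  · rw [replaceO₂_ofInt, replaceO₁_ofInt, replaceO₁_ofInt, replaceI₁_ofInt, replaceI₁_ofInt]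
    exact ofInt_eq_ofInt_mul (by norm_num) h2

theorem isGeneralProcess_ofInt {D : ℕ} {X : IntOp} (hX : IsNormalizedPositive (ofInt D X))
    (h1 : (2 : ℤ) • sumI₁ (sumO₁ X) = sumI₁ (sumO₁ (sumO₂ X)))
    (h2 : (2 : ℤ) • sumI₂ (sumO₂ X) = sumO₁ (sumI₂ (sumO₂ X)))
    (h3 : (4 : ℤ) • X = (2 : ℤ) • sumO₁ X + (2 : ℤ) • sumO₂ X - sumO₁ (sumO₂ X)) :
    IsGeneralProcess (ofInt D X) := by
  refine ⟨hX, ?_, ?_, ?_⟩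
  · rw [replaceO₂_ofInt, replaceO₁_ofInt, replaceO₁_ofInt, replaceI₁_ofInt, replaceI₁_ofInt]
    exact ofInt_eq_ofInt_mul (by norm_num) h1
  · rw [replaceO₂_ofInt, replaceI₂_ofInt, replaceO₁_ofInt]
    exact ofInt_eq_ofInt_mul (by norm_num) h2
  · rw [replaceO₂_ofInt, replaceO₁_ofInt, replaceO₁_ofInt]
    ext x y
    have h := congrArg (fun Y => ((Y x y : ℤ) : ℂ)) h3
    simp only [Matrix.sub_apply, Matrix.add_apply, Matrix.smul_apply, smul_eq_mul] at h
    push_cast at h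
    simp only [Matrix.sub_apply, Matrix.add_apply, ofInt_apply]
    push_cast
    linear_combination (1 / (4 * (D : ℂ))) * h

/-! ### Integer criteria for operators with a constant pairing -/

section ConstantPairing

variable {D : ℕ} {M : IntOp} {l : ℤ} {W : TwoSlot (Fin 2) (Fin 2)}

/-- The 4 in the denominator cancels the process trace `d_O² = 4`, so the scalar `l` of the integer
criteria is the numerator of the bound itself. -/
theorem re_le_of_eq_mul_card {z : ℂ}
    (h : z = ((l : ℂ) / ((4 * D : ℕ) : ℂ)) * (Fintype.card (Fin 2) * Fintype.card (Fin 2))) :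
    z.re ≤ (l : ℝ) / D := by
  have : z = (((l : ℝ) / D : ℝ) : ℂ) := by
    rw [h]
    simp only [Fintype.card_fin]
    push_cast
    ring
  rw [this, Complex.ofReal_re]

theorem IsParallelProcess.re_trace_mul_ofInt_le (hW : IsParallelProcess W)
    (h : sumO₂ (sumO₁ M) = l • (1 : IntOp)) :
    (W * ofInt D M).trace.re ≤ (l : ℝ) / D := by
  refine re_le_of_eq_mul_card (hW.trace_mul ?_)
  rw [replaceO₁_ofInt, replaceO₂_ofInt, ← mul_assoc, show 2 * 2 * D = 4 * D by ring]
  simpa only [one_mul] using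
    ofInt_eq_smul_one (D := 4 * D) one_ne_zero (by simpa only [Nat.cast_one, one_mul] using h)

theorem IsSequentialProcess.re_trace_mul_ofInt_le (hW : IsSequentialProcess W)
    (h1 : (2 : ℤ) • sumO₂ M = sumO₂ (sumI₂ M))
    (h2 : sumO₂ (sumI₂ (sumO₁ M)) = (2 * l) • (1 : IntOp)) :
    (W * ofInt D M).trace.re ≤ (l : ℝ) / D := by
  refine re_le_of_eq_mul_card (hW.trace_mul ?_ ?_)
  · rw [replaceO₂_ofInt, replaceI₂_ofInt, replaceO₂_ofInt]
    exact ofInt_eq_ofInt_mul (by norm_num) h1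
  · rw [replaceO₁_ofInt, replaceI₂_ofInt, replaceO₂_ofInt,
      show 2 * (2 * (2 * D)) = 2 * (4 * D) by ring]
    exact ofInt_eq_smul_one two_ne_zero h2

theorem IsReverseSequentialProcess.re_trace_mul_ofInt_le (hW : IsReverseSequentialProcess W)
    (h1 : (2 : ℤ) • sumO₁ M = sumO₁ (sumI₁ M))
    (h2 : sumO₂ (sumO₁ (sumI₁ M)) = (2 * l) • (1 : IntOp)) :
    (W * ofInt D M).trace.re ≤ (l : ℝ) / D := by
  refine re_le_of_eq_mul_card (hW.trace_mul ?_ ?_)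
  · rw [replaceO₁_ofInt, replaceI₁_ofInt, replaceO₁_ofInt]
    exact ofInt_eq_ofInt_mul (by norm_num) h1
  · rw [replaceI₁_ofInt, replaceO₁_ofInt, replaceO₂_ofInt,
      show 2 * (2 * (2 * D)) = 2 * (4 * D) by ring]
    exact ofInt_eq_smul_one two_ne_zero h2

/-- The weights 4, 2, 1 bring terms with one, two and three replacements to the common denominator
`8 * D`; this is also why the scalar is `2 * l`. -/
theorem IsGeneralProcess.re_trace_mul_ofInt_le (hW : IsGeneralProcess W)
    (h : (4 : ℤ) • sumO₁ M + (4 : ℤ) • sumO₂ M - (2 : ℤ) • sumO₂ (sumO₁ M)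
      - (2 : ℤ) • sumO₁ (sumI₁ M) + sumO₂ (sumO₁ (sumI₁ M))
      - (2 : ℤ) • sumO₂ (sumI₂ M) + sumO₂ (sumI₂ (sumO₁ M)) = (2 * l) • (1 : IntOp)) :
    (W * ofInt D M).trace.re ≤ (l : ℝ) / D := by
  refine re_le_of_eq_mul_card (hW.trace_mul ?_)
  rw [← ofInt_eq_smul_one two_ne_zero (D := 4 * D) h]
  simp only [replaceO₁_ofInt, replaceO₂_ofInt, replaceI₁_ofInt, replaceI₂_ofInt]
  ext x y
  simp only [Matrix.sub_apply, Matrix.add_apply, Matrix.smul_apply, smul_eq_mul, ofInt_apply]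
  push_cast
  ring

end ConstantPairing

/-! ### The two channels -/

section Channels

set_option linter.unusedSectionVars false

variable {I O : Type} [Fintype I] [DecidableEq I] [Fintype O] [DecidableEq O]

/-- The ampliation of `conjMap K` is conjugation by `1 ⊗ K`. -/
theorem isCompletelyPositive_conjMap (K : Matrix O I ℂ) : IsCompletelyPositive (conjMap K) := by
  intro k M hM
  convert hM.mul_mul_conjTranspose_same ((1 : Matrix (Fin k) (Fin k) ℂ) ⊗ₖ K) using 1
  ext ⟨a, x⟩ ⟨b, y⟩
  simp [ampliation, conjMap, Matrix.mul_apply, Fintype.sum_prod_type, Matrix.one_apply,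
    apply_ite]

theorem IsCompletelyPositive.add {Φ Ψ : Matrix I I ℂ →ₗ[ℂ] Matrix O O ℂ}
    (hΦ : IsCompletelyPositive Φ) (hΨ : IsCompletelyPositive Ψ) :
    IsCompletelyPositive (Φ + Ψ) := fun k M hM => (hΦ k M hM).add (hΨ k M hM)

theorem IsCompletelyPositive.smul {Φ : Matrix I I ℂ →ₗ[ℂ] Matrix O O ℂ}
    (hΦ : IsCompletelyPositive Φ) {c : ℂ} (hc : 0 ≤ c) :
    IsCompletelyPositive (c • Φ) := fun k M hM => (hΦ k M hM).smul hc

theorem isCompletelyPositive_id :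
    IsCompletelyPositive (LinearMap.id : Matrix I I ℂ →ₗ[ℂ] Matrix I I ℂ) := fun _ _ hM => hM

end Channels

theorem conjMap_apply_fin_two (K ρ : Matrix (Fin 2) (Fin 2) ℂ) (i j : Fin 2) :
    conjMap K ρ i j = K i 0 * ρ 0 0 * star (K j 0) + K i 0 * ρ 0 1 * star (K j 1) +
      K i 1 * ρ 1 0 * star (K j 0) + K i 1 * ρ 1 1 * star (K j 1) := by
  simp only [conjMap, LinearMap.coe_mk, AddHom.coe_mk, Matrix.mul_apply, Fin.sum_univ_two,
    conjTranspose_apply]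
  ring

theorem isQuantumChannel_amplitudeDamping {γ : ℝ} (h0 : 0 ≤ γ) (h1 : γ ≤ 1) :
    IsQuantumChannel (amplitudeDamping γ) := by
  refine ⟨(isCompletelyPositive_conjMap _).add (isCompletelyPositive_conjMap _), fun ρ => ?_⟩
  have e1 : ((Real.sqrt (1 - γ) : ℝ) : ℂ) * (Real.sqrt (1 - γ) : ℝ) = 1 - γ := by
    rw [← Complex.ofReal_mul, Real.mul_self_sqrt (by linarith)]; push_cast; ring
  have e2 : ((Real.sqrt γ : ℝ) : ℂ) * (Real.sqrt γ : ℝ) = γ := by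
    rw [← Complex.ofReal_mul, Real.mul_self_sqrt h0]
  simp [amplitudeDamping, conjMap_apply_fin_two, Matrix.trace_fin_two]
  linear_combination ρ 1 1 * e1 + ρ 1 1 * e2

theorem isQuantumChannel_bitFlip {η : ℝ} (h0 : 0 ≤ η) (h1 : η ≤ 1) :
    IsQuantumChannel (bitFlip η) := by
  refine ⟨(isCompletelyPositive_id.smul (by exact_mod_cast h0)).add
    ((isCompletelyPositive_conjMap _).smul ?_), fun ρ => ?_⟩
  · exact_mod_cast sub_nonneg.2 h1
  · simp [bitFlip, conjMap_apply_fin_two, Matrix.trace_fin_two]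
    ring

/-- The ensemble of an amplitude-damping and a bit-flip channel. -/
def dampingFlipEnsemble : ChannelEnsemble (Fin 2) (Fin 2) 2 where
  prob _ := 1 / 2
  prob_nonneg _ := by norm_num
  prob_sum := by norm_num
  channel := ![amplitudeDamping (67 / 100), bitFlip (87 / 100)]
  isQuantumChannel i := by
    fin_cases i
    · exact isQuantumChannel_amplitudeDamping (by norm_num) (by norm_num)
    · exact isQuantumChannel_bitFlip (by norm_num) (by norm_num)

/-- The diagonal of the Choi operator of the amplitude-damping channel, times 100. -/
def dampingDiag : Matrix (Fin 2 × Fin 2) (Fin 2 × Fin 2) ℤ := Matrix.of fun x y =>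
  if x = y then ![![100, 0], ![67, 33]] x.1 x.2 else 0

/-- The coherences `|00⟩⟨11| + |11⟩⟨00|`. -/
def coherence : Matrix (Fin 2 × Fin 2) (Fin 2 × Fin 2) ℤ := Matrix.of fun x y =>
  if x.1 = x.2 ∧ y.1 = y.2 ∧ x ≠ y then 1 else 0

/-- The Choi operator of the bit-flip channel, times 100. -/
def flipChoi : Matrix (Fin 2 × Fin 2) (Fin 2 × Fin 2) ℤ := Matrix.of fun x y =>
  if x.1 = x.2 ∧ y.1 = y.2 then 87 else if x.1 ≠ x.2 ∧ y.1 ≠ y.2 then 13 else 0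

/-- The coherence parameter `√(1 - γ)`. -/
def damp : ℝ := Real.sqrt (1 - 67 / 100)

theorem damp_sq : damp * damp = 33 / 100 := by
  rw [damp, Real.mul_self_sqrt (by norm_num)]; norm_num

theorem choi_amplitudeDamping (x y : Fin 2 × Fin 2) :
    choi (amplitudeDamping (67 / 100)) x y =
      ((dampingDiag x y : ℂ) + 100 * damp * coherence x y) / 100 := by
  have e1 : (damp : ℂ) * damp = 33 / 100 := by
    rw [← Complex.ofReal_mul, damp_sq]; norm_num
  have e2 : ((Real.sqrt (67 / 100) : ℝ) : ℂ) * (Real.sqrt (67 / 100) : ℝ) = 67 / 100 := by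
    rw [← Complex.ofReal_mul, Real.mul_self_sqrt (by norm_num)]; norm_num
  obtain ⟨a, b⟩ := x
  obtain ⟨c, d⟩ := y
  unfold amplitudeDamping
  rw [← damp]
  -- Only the square of this root occurs in the Choi operator, and `e2` supplies it.
  generalize Real.sqrt (67 / 100) = w at *
  fin_cases a <;> fin_cases b <;> fin_cases c <;> fin_cases d <;>
    simp [choi, conjMap_apply_fin_two, Matrix.single_apply, dampingDiag, coherence, e1, e2]

theorem choi_bitFlip (x y : Fin 2 × Fin 2) :
    choi (bitFlip (87 / 100)) x y = (flipChoi x y : ℂ) / 100 := by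
  obtain ⟨a, b⟩ := x
  obtain ⟨c, d⟩ := y
  fin_cases a <;> fin_cases b <;> fin_cases c <;> fin_cases d <;>
    simp [choi, bitFlip, conjMap_apply_fin_two, Matrix.single_apply, flipChoi] <;> norm_num

/-- The part of two copies of the amplitude-damping channel without `√(1 - γ)`, times `10⁴`. -/
def dampingEven : IntOp :=
  dampingDiag ⊗ₖ dampingDiag + (3300 : ℤ) • (coherence ⊗ₖ coherence)

/-- The coefficient of `√(1 - γ)` in two copies of the amplitude-damping channel, times `10⁴`. -/
def dampingOdd : IntOp :=
  (100 : ℤ) • (dampingDiag ⊗ₖ coherence + coherence ⊗ₖ dampingDiag)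

/-- Two copies of the bit-flip channel, times `10⁴`. -/
def flipTwo : IntOp := flipChoi ⊗ₖ flipChoi

/-- The product of two coherences carries `(100 √(1 - γ))² = 3300` and so belongs to the rational
part; only the mixed terms keep the root. -/
theorem choi_amplitudeDamping_two :
    choi (amplitudeDamping (67 / 100)) ⊗ₖ choi (amplitudeDamping (67 / 100)) =
      ofInt 10000 dampingEven + (damp : ℂ) • ofInt 10000 dampingOdd := by
  have e1 : (damp : ℂ) * damp = 33 / 100 := by
    rw [← Complex.ofReal_mul, damp_sq]; norm_num
  ext x y
  simp only [kroneckerMap_apply, choi_amplitudeDamping, Matrix.add_apply, Matrix.smul_apply,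
    ofInt_apply, dampingEven, dampingOdd, smul_eq_mul]
  push_cast
  linear_combination (coherence x.1 y.1 * coherence x.2 y.2 : ℂ) * e1

theorem choi_bitFlip_two :
    choi (bitFlip (87 / 100)) ⊗ₖ choi (bitFlip (87 / 100)) = ofInt 10000 flipTwo := by
  ext x y
  simp only [kroneckerMap_apply, choi_bitFlip, ofInt_apply, flipTwo]
  push_cast
  ring

/-! ### Certificates

The number `√(1 - γ)` lies between `k / 10¹⁰` and `(k + 1) / 10¹⁰` for `k = 5744562646`, and all
conditions are affine in it. -/

/-- Ten-digit truncation of `√(1 - γ)`. -/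
def dampDigits : ℤ := 5744562646

theorem dampDigits_le : (dampDigits : ℝ) ≤ 10 ^ 10 * damp := by
  have : (dampDigits : ℝ) / 10 ^ 10 ≤ damp := Real.le_sqrt_of_sq_le (by norm_num [dampDigits])
  linarith

theorem le_dampDigits : 10 ^ 10 * damp ≤ dampDigits + 1 := by
  have : damp ≤ ((dampDigits : ℝ) + 1) / 10 ^ 10 :=
    Real.sqrt_le_iff.2 ⟨by norm_num [dampDigits], by norm_num [dampDigits]⟩
  linarith

/-- `2 · 10¹⁴ D (M / D - C / 2)` with `C` two copies of the amplitude-damping channel in which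
`√(1 - γ)` is replaced by `k / 10¹⁰`. -/
def dampingSlack (D : ℕ) (M : IntOp) (k : ℤ) : IntOp :=
  (20000 * 10 ^ 10 : ℤ) • M - (D : ℤ) • ((10 ^ 10 : ℤ) • dampingEven + k • dampingOdd)

/-- `2 · 10⁴ D (M / D - C / 2)` with `C` two copies of the bit-flip channel. -/
def flipSlack (D : ℕ) (M : IntOp) : IntOp := (20000 : ℤ) • M - (D : ℤ) • flipTwo

/-- `M / D` dominates the operators of the two hypotheses. -/
def Dominates (D : ℕ) (M : IntOp) : Prop :=
  IsBlockPositive (dampingSlack D M dampDigits) ∧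
    IsBlockPositive (dampingSlack D M (dampDigits + 1)) ∧ IsBlockPositive (flipSlack D M)

instance (D : ℕ) (M : IntOp) : Decidable (Dominates D M) := inferInstanceAs (Decidable (_ ∧ _))

theorem Dominates.posSemidef {D : ℕ} (hD : D ≠ 0) {M : IntOp} (h : Dominates D M) (i : Fin 2) :
    (ofInt D M - ((dampingFlipEnsemble.prob i : ℝ) : ℂ) •
      (choi (dampingFlipEnsemble.channel i) ⊗ₖ choi (dampingFlipEnsemble.channel i))).PosSemidef := by
  have hD' : (D : ℂ) ≠ 0 := by exact_mod_cast hD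
  obtain ⟨h1, h2, h3⟩ := h
  fin_cases i
  -- The slack is affine in the root, hence the convex combination of the slacks at the two
  -- endpoints, with weights `k + 1 - 10¹⁰ √(1 - γ)` and `10¹⁰ √(1 - γ) - k`.
  · have p1 := (h1.posSemidef (20000 * 10 ^ 10 * D)).smul
      (a := ((dampDigits + 1 - 10 ^ 10 * damp : ℝ) : ℂ))
      (by exact_mod_cast sub_nonneg.2 le_dampDigits)
    have p2 := (h2.posSemidef (20000 * 10 ^ 10 * D)).smul
      (a := ((10 ^ 10 * damp - dampDigits : ℝ) : ℂ))
      (by exact_mod_cast sub_nonneg.2 dampDigits_le)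
    convert p1.add p2 using 1
    change ofInt D M - (((1 / 2 : ℝ)) : ℂ) • (choi (amplitudeDamping (67 / 100)) ⊗ₖ
      choi (amplitudeDamping (67 / 100))) = _
    rw [choi_amplitudeDamping_two]
    ext x y
    simp only [Matrix.sub_apply, Matrix.add_apply, Matrix.smul_apply, smul_eq_mul, ofInt_apply,
      dampingSlack]
    push_cast
    field_simp
    ring
  · convert h3.posSemidef (20000 * D) using 1
    change ofInt D M - (((1 / 2 : ℝ)) : ℂ) • (choi (bitFlip (87 / 100)) ⊗ₖ
      choi (bitFlip (87 / 100))) = _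
    rw [choi_bitFlip_two]
    ext x y
    simp only [Matrix.sub_apply, Matrix.smul_apply, smul_eq_mul, ofInt_apply, flipSlack]
    push_cast
    field_simp
    ring

/-- `2 · 10¹⁴ D` times the success probability of the tester `X / D`, with `√(1 - γ)` replaced by
`k / 10¹⁰`. -/
def scaledSuccess (X : Fin 2 → IntOp) (k : ℤ) : ℤ :=
  10 ^ 10 * ((X 0 * dampingEven).trace + (X 1 * flipTwo).trace) + k * (X 0 * dampingOdd).trace

theorem trace_ofInt_mul_ofInt (D D' : ℕ) (X Y : IntOp) :
    (ofInt D X * ofInt D' Y).trace = ((X * Y).trace : ℂ) / (D * D') := by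
  simp only [Matrix.trace, Matrix.diag, Matrix.mul_apply, ofInt_apply]
  push_cast
  simp only [Finset.sum_div]
  refine Finset.sum_congr rfl fun x _ => Finset.sum_congr rfl fun y _ => ?_
  ring

theorem lt_success_of_lt_scaledSuccess {D : ℕ} (hD : D ≠ 0) {X : Fin 2 → IntOp} {b : ℤ}
    (h1 : b * (2 * D * 10 ^ 10) < scaledSuccess X dampDigits)
    (h2 : b * (2 * D * 10 ^ 10) < scaledSuccess X (dampDigits + 1)) :
    (b : ℝ) / 10000 < dampingFlipEnsemble.success fun i => ofInt D (X i) := by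
  have hD' : (0 : ℝ) < D := by exact_mod_cast Nat.pos_of_ne_zero hD
  have hs : dampingFlipEnsemble.success (fun i => ofInt D (X i)) =
      (((X 0 * dampingEven).trace + (X 1 * flipTwo).trace : ℤ) +
        damp * ((X 0 * dampingOdd).trace : ℤ)) / (20000 * D) := by
    rw [ChannelEnsemble.success, Fin.sum_univ_two]
    change 1 / 2 * (ofInt D (X 0) * (choi (amplitudeDamping (67 / 100)) ⊗ₖ
      choi (amplitudeDamping (67 / 100)))).trace.re + 1 / 2 * (ofInt D (X 1) *
      (choi (bitFlip (87 / 100)) ⊗ₖ choi (bitFlip (87 / 100)))).trace.re = _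
    rw [choi_amplitudeDamping_two, choi_bitFlip_two, mul_add, mul_smul_comm, trace_add, trace_smul,
      trace_ofInt_mul_ofInt, trace_ofInt_mul_ofInt, trace_ofInt_mul_ofInt, smul_eq_mul,
      Complex.add_re, Complex.re_ofReal_mul]
    have hre : ∀ t : ℤ, ((t : ℂ) / ((D : ℂ) * ((10000 : ℕ) : ℂ))).re = (t : ℝ) / (D * 10000) :=
      fun t => by
        rw [show (t : ℂ) / ((D : ℂ) * ((10000 : ℕ) : ℂ)) = (((t : ℝ) / (D * 10000) : ℝ) : ℂ) by
          push_cast; rfl, Complex.ofReal_re]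
    rw [hre, hre, hre]
    push_cast
    field_simp
    ring
  rw [hs, div_lt_div_iff₀ (by norm_num) (by positivity)]
  unfold scaledSuccess at h1 h2
  generalize (X 0 * dampingEven).trace + (X 1 * flipTwo).trace = u at *
  generalize (X 0 * dampingOdd).trace = v at *
  have g1 : (b : ℝ) * (2 * D * 10 ^ 10) < 10 ^ 10 * u + dampDigits * v := by exact_mod_cast h1
  have g2 : (b : ℝ) * (2 * D * 10 ^ 10) < 10 ^ 10 * u + (dampDigits + 1) * v := by
    exact_mod_cast h2
  have a1 := dampDigits_le
  have a2 := le_dampDigits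
  -- The success is affine in the root with slope proportional to `v`, whose sign selects the
  -- endpoint giving the smaller value.
  rcases le_total 0 (v : ℝ) with hv | hv
  · have := mul_le_mul_of_nonneg_right a1 hv
    linarith
  · have := mul_le_mul_of_nonpos_right a2 hv
    linarith

/-! ### Explicit testers and dual operators -/

/-- A dual operator for parallel strategies, times 250000. -/
def parallelDual : IntOp := ofBlocks
  !![157642, 112767, 112767, 89404; 112767, 100228, 100215, 93005; 112767, 100215, 100228, 93005;
    89404, 93005, 93005, 95075]
  !![22315, -6761, 20212, 4717; -6761, 86017, -6761, 46532; 20212, -6761, 20219, 4717; 4717, 46532,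
    4717, 28739]
  (swapBlock !![22315, -6761, 20212, 4717; -6761, 86017, -6761, 46532; 20212, -6761, 20219, 4717;
    4717, 46532, 4717, 28739])
  !![6395, 2190, 2190, 28; 2190, 2203, 2190, 28; 2190, 2190, 2203, 28; 28, 28, 28, 56114]

/-- The first element of a parallel tester, times 2500000. -/
def parallelTester₀ : IntOp := ofBlocks
  !![150, 183, 183, -400; 183, 204649, 47532, -214679; 183, 47532, 204649, -214679; -400, -214679,
    -214679, 365569]
  !![149, 16, -98, -195; 16, 213345, 16685, 234630; -98, 16685, 53576, -205303; -195, 234630,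
    -205303, 1217995]
  (swapBlock !![149, 16, -98, -195; 16, 213345, 16685, 234630; -98, 16685, 53576, -205303; -195,
    234630, -205303, 1217995])
  !![149, -74, -74, -12; -74, 78745, -78371, -12116; -74, -78371, 78745, -12116; -12, -12116,
    -12116, 1870288]

/-- The second element of a parallel tester, times 2500000. -/
def parallelTester₁ : IntOp := ofBlocks
  !![149, -183, -183, 400; -183, 109584, -47532, 214679; -183, -47532, 109584, 214679; 400, 214679,
    214679, 1505666]
  !![150, -16, 98, 195; -16, 100888, -16685, -234630; 98, -16685, 260657, 205303; 195, -234630,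
    205303, 653240]
  (swapBlock !![150, -16, 98, 195; -16, 100888, -16685, -234630; 98, -16685, 260657, 205303; 195,
    -234630, 205303, 653240])
  !![150, 74, 74, 12; 74, 235488, 78371, 12116; 74, 78371, 235488, 12116; 12, 12116, 12116, 947]

/-- A dual operator for sequential strategies, times 25000000. -/
def sequentialDual : IntOp := ofBlocks
  !![16069017, 11376281, 11648625, 9030691; 11376281, 10083759, 10072658, 9319656; 11648625,
    10072658, 10194346, 9323784; 9030691, 9319656, 9323784, 9493699]
  !![2654453, -720148, 2317208, 456486; -720148, 8639711, -720148, 4646177; 2317208, -720148,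
    2166551, 456486; 456486, 4646177, 456486, 2867198]
  !![1928301, 1687884, 169040, 736798; 1687884, 1928301, 32255, 666381; 169040, 32255, 8453451,
    4825148; 736798, 666381, 4825148, 3106010]
  !![465692, 225275, 362059, -64866; 225275, 465692, 225275, -135282; 362059, 225275, 303115,
    -64866; -64866, -135282, -64866, 5650556]

/-- The first element of a sequential tester, times 25000. -/
def sequentialTester₀ : IntOp := ofBlocks
  !![1475, 628, -3290, 1387; 628, 374, -1404, 502; -3290, -1404, 7354, -3104; 1387, 502, -3104,
    1390]
  !![90, 265, -189, 859; 265, 1667, -597, 4132; -189, -597, 412, -1938; 859, 4132, -1938, 11386]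
  !![1834, -711, -3201, -2425; -711, 279, 1241, 934; -3201, 1241, 5612, 4231; -2425, 934, 4231,
    3225]
  !![77, 37, -100, 90; 37, 1220, -66, 4138; -100, -66, 141, -160; 90, 4138, -160, 14133]

/-- The second element of a sequential tester, times 25000. -/
def sequentialTester₁ : IntOp := ofBlocks
  !![375, -628, -856, -1387; -628, 1385, 1404, 3644; -856, 1404, 1969, 3104; -1387, 3644, 3104,
    10678]
  !![1760, -265, -3957, -859; -265, 92, 597, 14; -3957, 597, 8911, 1938; -859, 14, 1938, 682]
  !![545, 711, -939, 2425; 711, 951, -1241, 3206; -939, -1241, 1642, -4231; 2425, 3206, -4231,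
    10912]
  !![2302, -37, -4040, -90; -37, 10, 66, 2; -4040, 66, 7113, 160; -90, 2, 160, 4]

/-- A dual operator for separable strategies, times 25000000. -/
def separableDual : IntOp := ofBlocks
  !![15661638, 11548132, 11548132, 9175923; 11548132, 10165433, 10165095, 9364541; 11548132,
    10165095, 10165433, 9364541; 9175923, 9364541, 9364541, 9474705]
  !![1804594, -222024, 1801997, 634608; -222024, 8404657, -223202, 4730890; 1801997, -223202,
    1800591, 635049; 634608, 4730890, 635049, 2988868]
  (swapBlock !![1804594, -222024, 1801997, 634608; -222024, 8404657, -223202, 4730890; 1801997,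
    -223202, 1800591, 635049; 634608, 4730890, 635049, 2988868])
  !![515899, 356076, 356076, -149676; 356076, 285277, 285074, -119087; 356076, 285074, 285277,
    -119087; -149676, -119087, -119087, 5661052]

/-- An operator that dominates `separableDual` and pairs to a constant with sequential
    processes,
times 25000000. -/
def separableMajorant : IntOp := ofBlocks
  !![16216804, 11548132, 11919898, 9175923; 11548132, 10168670, 10165095, 9363657; 11919898,
    10165095, 10414491, 9364541; 9175923, 9363657, 9364541, 9474988]
  !![2359760, -222024, 2173765, 634608; -222024, 8407894, -223202, 4730006; 2173765, -223202,
    2049648, 635049; 634608, 4730006, 635049, 2989151]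
  !![1964815, 1801997, -150810, 634608; 1801997, 2078124, -223202, 515308; -150810, -223202,
    8436370, 4730890; 634608, 515308, 4730890, 3040588]
  !![676120, 356076, 427290, -149676; 356076, 562811, 285074, -238828; 427290, 285074, 316990,
    -119087; -149676, -238828, -119087, 5712772]

/-- The first element of a separable tester, times 500000. -/
def separableTester₀ : IntOp := ofBlocks
  !![46074, -29630, -29630, 22420; -29630, 37862, 2358, -16236; -29630, 2358, 37862, -16236; 22420,
    -16236, -16236, 14048]
  !![27046, -35692, -23190, -23440; -35692, 97616, 14754, 93458; -23190, 14754, 26004, -2740;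
    -23440, 93458, -2740, 106858]
  (swapBlock !![27046, -35692, -23190, -23440; -35692, 97616, 14754, 93458; -23190, 14754, 26004,
    -2740; -23440, 93458, -2740, 106858])
  !![622, 218, 218, 2908; 218, 39508, -22024, 42472; 218, -22024, 39508, 42472; 2908, 42472, 42472,
    212736]

/-- The second element of a separable tester, times 500000. -/
def separableTester₁ : IntOp := ofBlocks
  !![4236, -7846, -7846, -22420; -7846, 33148, -2358, 53712; -7846, -2358, 33148, 53712; -22420,
    53712, 53712, 293622]
  !![18567, -10126, -14286, 23440; -10126, 20750, -14754, -55982; -14286, -14754, 49703, 48558;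
    23440, -55982, 48558, 153456]
  (swapBlock !![18567, -10126, -14286, 23440; -10126, 20750, -14754, -55982; -14286, -14754, 49703,
    48558; 23440, -55982, 48558, 153456])
  !![40294, -46036, -46036, -2908; -46036, 83555, 22024, 3346; -46036, 22024, 83555, 3346; -2908,
    3346, 3346, 222]

/-- A sequential process whose equal mixture with its slot exchange is the sum of the separable
    tester,
times 500000. -/
def separableOrdered : IntOp := ofBlocks
  !![50310, 0, -74952, 0; 0, 30188, 0, 74952; -74952, 0, 111832, 0; 0, 74952, 0, 307670]
  !![50310, 0, -74952, 0; 0, 30188, 0, 74952; -74952, 0, 111832, 0; 0, 74952, 0, 307670]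
  !![40916, 0, -91636, 0; 0, 39582, 0, 91636; -91636, 0, 206544, 0; 0, 91636, 0, 212958]
  !![40916, 0, -91636, 0; 0, 39582, 0, 91636; -91636, 0, 206544, 0; 0, 91636, 0, 212958]

/-- A dual operator for general strategies, times 250000. -/
def generalDual : IntOp := ofBlocks
  !![165733, 118705, 118705, 91613; 118705, 102787, 102774, 93595; 118705, 102774, 102787, 93595;
    91613, 93595, 93595, 94740]
  !![21650, 265, 22000, 5599; 265, 84596, 413, 47110; 22000, 413, 22399, 5503; 5599, 47110, 5503,
    30446]
  (swapBlock !![21650, 265, 22000, 5599; 265, 84596, 413, 47110; 22000, 413, 22399, 5503; 5599,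
    47110, 5503, 30446])
  !![3829, 3386, 3386, -2040; 3386, 3080, 3073, -1852; 3386, 3073, 3080, -1852; -2040, -1852,
    -1852, 57230]

/-- The first element of a general tester, times 25000000. -/
def generalTester₀ : IntOp := ofBlocks
  !![339015, -462768, -462768, 587016; -462768, 1470870, -207230, -801513; -462768, -207230,
    1470870, -801513; 587016, -801513, -801513, 1016816]
  !![1416005, -2160052, -904396, -1820523; -2160052, 5970693, 828591, 4813638; -904396, 828591,
    691139, 743304; -1820523, 4813638, 743304, 3890873]
  (swapBlock !![1416005, -2160052, -904396, -1820523; -2160052, 5970693, 828591, 4813638; -904396,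
    828591, 691139, 743304; -1820523, 4813638, 743304, 3890873])
  !![7978, 29005, 29005, 110920; 29005, 2259813, -620213, 2776711; 29005, -620213, 2259813,
    2776711; 110920, 2776711, 2776711, 9428574]

/-- The second element of a general tester, times 25000000. -/
def generalTester₁ : IntOp := ofBlocks
  !![400762, -628597, -628597, -587016; -628597, 1885329, 207230, 1892878; -628597, 207230,
    1885329, 1892878; -587016, 1892878, 1892878, 16531009]
  !![978014, -695895, -186969, 1820523; -695895, 1443601, -828591, -3722273; -186969, -828591,
    1010818, 2112643; 1820523, -3722273, 2112643, 9598857]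
  (swapBlock !![978014, -695895, -186969, 1820523; -695895, 1443601, -828591, -3722273; -186969,
    -828591, 1010818, 2112643; 1820523, -3722273, 2112643, 9598857])
  !![4040283, -2884952, -2884952, -110920; -2884952, 3500239, 620213, 79236; -2884952, 620213,
    3500239, 79236; -110920, 79236, 79236, 3061]

/-! ### Feasibility of the explicit testers -/

theorem isTester_ofInt {S : Strategy} {D : ℕ} (hD : D ≠ 0) {X₀ X₁ : IntOp}
    (h0 : IsBlockPositive X₀) (h1 : IsBlockPositive X₁) (ht : (X₀ + X₁).trace = 4 * D)
    (h : IsNormalizedPositive (ofInt D (X₀ + X₁)) → IsProcess S (ofInt D (X₀ + X₁))) :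
    IsTester S fun i : Fin 2 => ofInt D (![X₀, X₁] i) := by
  have hs : ofInt D (X₀ + X₁) = ofInt D X₀ + ofInt D X₁ := by
    ext x y
    simp only [Matrix.add_apply, ofInt_apply]
    push_cast
    ring
  refine ⟨fun i => ?_, ?_⟩
  · fin_cases i
    · exact h0.posSemidef D
    · exact h1.posSemidef D
  · rw [Fin.sum_univ_two]
    change IsProcess S (ofInt D X₀ + ofInt D X₁)
    rw [← hs]
    refine h (isNormalizedPositive_ofInt hD ?_ ht)
    rw [hs]
    exact (h0.posSemidef D).add (h1.posSemidef D)

theorem isTester_parallelTester :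
    IsTester .par fun i : Fin 2 => ofInt 2500000 (![parallelTester₀, parallelTester₁] i) :=
  isTester_ofInt (by norm_num) (by decide +kernel) (by decide +kernel) (by decide +kernel)
    fun hX => isParallelProcess_ofInt hX (by decide +kernel)

theorem isTester_sequentialTester :
    IsTester .seq fun i : Fin 2 => ofInt 25000 (![sequentialTester₀, sequentialTester₁] i) :=
  isTester_ofInt (by norm_num) (by decide +kernel) (by decide +kernel) (by decide +kernel)
    fun hX => isSequentialProcess_ofInt hX (by decide +kernel) (by decide +kernel)

theorem isTester_generalTester :
    IsTester .gen fun i : Fin 2 => ofInt 25000000 (![generalTester₀, generalTester₁] i) :=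
  isTester_ofInt (by norm_num) (by decide +kernel) (by decide +kernel) (by decide +kernel)
    fun hX => isGeneralProcess_ofInt hX (by decide +kernel) (by decide +kernel)
      (by decide +kernel)

theorem isSequentialProcess_separableOrdered :
    IsSequentialProcess (ofInt 500000 separableOrdered) :=
  isSequentialProcess_ofInt (isNormalizedPositive_ofInt (by norm_num)
    (IsBlockPositive.posSemidef (by decide +kernel) _) (by decide +kernel))
    (by decide +kernel) (by decide +kernel)

theorem isReverseSequentialProcess_separableOrdered :
    IsReverseSequentialProcess (ofInt 500000 (swapSlots separableOrdered)) :=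
  isReverseSequentialProcess_ofInt (isNormalizedPositive_ofInt (by norm_num)
    (IsBlockPositive.posSemidef (by decide +kernel) _) (by decide +kernel))
    (by decide +kernel) (by decide +kernel)

/-- The tester is invariant under exchange of the slots, so its sum can be the equal mixture of one
ordered process and its exchange. The final coefficient is `1 / (2 * 500000)`. -/
theorem isTester_separableTester :
    IsTester .sep fun i : Fin 2 => ofInt 500000 (![separableTester₀, separableTester₁] i) := by
  refine isTester_ofInt (by norm_num) (by decide +kernel) (by decide +kernel) (by decide +kernel)
    fun _ => ⟨1 / 2, _, _, by norm_num, by norm_num, isSequentialProcess_separableOrdered,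
      isReverseSequentialProcess_separableOrdered, ?_⟩
  have h : (2 : ℤ) • (separableTester₀ + separableTester₁) =
      separableOrdered + swapSlots separableOrdered := by decide +kernel
  ext x y
  have hxy := congrArg (fun Y => ((Y x y : ℤ) : ℂ)) h
  simp only [Matrix.smul_apply, Matrix.add_apply, smul_eq_mul] at hxy
  push_cast at hxy
  simp only [Matrix.add_apply, Matrix.smul_apply, ofInt_apply, smul_eq_mul]
  push_cast
  linear_combination (1 / 1000000 : ℂ) * hxy

/-! ### Lower bounds from the explicit testers -/

theorem lt_success_parallelTester : (8346 : ℝ) / 10000 < dampingFlipEnsemble.success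
    fun i => ofInt 2500000 (![parallelTester₀, parallelTester₁] i) := by
  simpa only [Int.cast_ofNat] using lt_success_of_lt_scaledSuccess (D := 2500000) (b := 8346)
    (X := ![parallelTester₀, parallelTester₁]) (by norm_num) (by decide +kernel) (by decide +kernel)

theorem lt_success_sequentialTester : (8446 : ℝ) / 10000 < dampingFlipEnsemble.success
    fun i => ofInt 25000 (![sequentialTester₀, sequentialTester₁] i) := by
  simpa only [Int.cast_ofNat] using lt_success_of_lt_scaledSuccess (D := 25000) (b := 8446)
    (X := ![sequentialTester₀, sequentialTester₁]) (by norm_num) (by decide +kernel) (by decide +kernel)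

theorem lt_success_separableTester : (8486 : ℝ) / 10000 < dampingFlipEnsemble.success
    fun i => ofInt 500000 (![separableTester₀, separableTester₁] i) := by
  simpa only [Int.cast_ofNat] using lt_success_of_lt_scaledSuccess (D := 500000) (b := 8486)
    (X := ![separableTester₀, separableTester₁]) (by norm_num) (by decide +kernel) (by decide +kernel)

theorem lt_success_generalTester : (8514 : ℝ) / 10000 < dampingFlipEnsemble.success
    fun i => ofInt 25000000 (![generalTester₀, generalTester₁] i) := by
  simpa only [Int.cast_ofNat] using lt_success_of_lt_scaledSuccess (D := 25000000) (b := 8514)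
    (X := ![generalTester₀, generalTester₁]) (by norm_num) (by decide +kernel) (by decide +kernel)

/-! ### Upper bounds -/

/-- The numerator is the scalar `l` to which the partial traces of the dual operator reduce; here
`208667 / 250000 = 0.834668`. The other three bounds arise likewise, the separable one from its
majorant. -/
theorem success_le_parallelDual {T : Fin 2 → TwoSlot (Fin 2) (Fin 2)} (hT : IsTester .par T) :
    dampingFlipEnsemble.success T ≤ ((208667 : ℤ) : ℝ) / (250000 : ℕ) :=
  dampingFlipEnsemble.success_le (S := .par)
    (Dominates.posSemidef (D := 250000) (M := parallelDual) (by norm_num) (by decide +kernel))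
    (fun W hW => IsParallelProcess.re_trace_mul_ofInt_le hW (by decide +kernel)) hT

theorem success_le_sequentialDual {T : Fin 2 → TwoSlot (Fin 2) (Fin 2)} (hT : IsTester .seq T) :
    dampingFlipEnsemble.success T ≤ ((21117463 : ℤ) : ℝ) / (25000000 : ℕ) :=
  dampingFlipEnsemble.success_le (S := .seq)
    (Dominates.posSemidef (D := 25000000) (M := sequentialDual) (by norm_num) (by decide +kernel))
    (fun W hW => IsSequentialProcess.re_trace_mul_ofInt_le hW (by decide +kernel)
      (by decide +kernel)) hT

theorem success_le_separableDual {T : Fin 2 → TwoSlot (Fin 2) (Fin 2)} (hT : IsTester .sep T) :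
    dampingFlipEnsemble.success T ≤ ((21217499 : ℤ) : ℝ) / (25000000 : ℕ) :=
  dampingFlipEnsemble.success_le (S := .sep)
    (Dominates.posSemidef (D := 25000000) (M := separableDual) (by norm_num) (by decide +kernel))
    (fun W hW => by
      have hsub : ∀ X Y : IntOp, ofInt 25000000 (X - Y) = ofInt 25000000 X - ofInt 25000000 Y := fun X Y => by
        ext x y
        simp only [Matrix.sub_apply, ofInt_apply]
        push_cast
        ring
      have h12 : (ofInt 25000000 separableMajorant - ofInt 25000000 separableDual).PosSemidef := by
        rw [← hsub]
        exact IsBlockPositive.posSemidef (by decide +kernel) _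
      -- Since `separableDual` is invariant under exchange of the slots, the exchanged majorant
      -- serves for the reverse order.
      have h21 : (ofInt 25000000 (swapSlots separableMajorant) -
          ofInt 25000000 separableDual).PosSemidef := by
        rw [← hsub]
        exact IsBlockPositive.posSemidef (by decide +kernel) _
      exact IsSeparableProcess.re_trace_mul_le hW h12 h21
        (fun V hV => hV.re_trace_mul_ofInt_le (by decide +kernel) (by decide +kernel))
        (fun V hV => hV.re_trace_mul_ofInt_le (by decide +kernel) (by decide +kernel))) hT

theorem success_le_generalDual {T : Fin 2 → TwoSlot (Fin 2) (Fin 2)} (hT : IsTester .gen T) :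
    dampingFlipEnsemble.success T ≤ ((212862 : ℤ) : ℝ) / (250000 : ℕ) :=
  dampingFlipEnsemble.success_le (S := .gen)
    (Dominates.posSemidef (D := 250000) (M := generalDual) (by norm_num) (by decide +kernel))
    (fun W hW => IsGeneralProcess.re_trace_mul_ofInt_le hW (by decide +kernel)) hT

/-! ### The maxima -/

theorem isGreatest_maxSuccess_dampingFlip (S : Strategy) :
    IsGreatest (dampingFlipEnsemble.successSet S) (dampingFlipEnsemble.maxSuccess S) := by
  cases S with
  | par => exact dampingFlipEnsemble.isGreatest_maxSuccess isTester_parallelTester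
  | seq => exact dampingFlipEnsemble.isGreatest_maxSuccess isTester_sequentialTester
  | sep => exact dampingFlipEnsemble.isGreatest_maxSuccess isTester_separableTester
  | gen => exact dampingFlipEnsemble.isGreatest_maxSuccess isTester_generalTester

theorem maxSuccess_parallel_mem_Ioo :
    (8346 : ℝ) / 10000 < dampingFlipEnsemble.maxSuccess .par ∧
      dampingFlipEnsemble.maxSuccess .par < 8347 / 10000 := by
  have h := isGreatest_maxSuccess_dampingFlip .par
  obtain ⟨T, hT, hmax⟩ := h.1
  exact ⟨lt_success_parallelTester.trans_le (h.2 ⟨_, isTester_parallelTester, rfl⟩),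
    hmax.trans_lt ((success_le_parallelDual hT).trans_lt (by norm_num))⟩

theorem maxSuccess_sequential_mem_Ioo :
    (8446 : ℝ) / 10000 < dampingFlipEnsemble.maxSuccess .seq ∧
      dampingFlipEnsemble.maxSuccess .seq < 8447 / 10000 := by
  have h := isGreatest_maxSuccess_dampingFlip .seq
  obtain ⟨T, hT, hmax⟩ := h.1
  exact ⟨lt_success_sequentialTester.trans_le (h.2 ⟨_, isTester_sequentialTester, rfl⟩),
    hmax.trans_lt ((success_le_sequentialDual hT).trans_lt (by norm_num))⟩

theorem maxSuccess_separable_mem_Ioo :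
    (8486 : ℝ) / 10000 < dampingFlipEnsemble.maxSuccess .sep ∧
      dampingFlipEnsemble.maxSuccess .sep < 8487 / 10000 := by
  have h := isGreatest_maxSuccess_dampingFlip .sep
  obtain ⟨T, hT, hmax⟩ := h.1
  exact ⟨lt_success_separableTester.trans_le (h.2 ⟨_, isTester_separableTester, rfl⟩),
    hmax.trans_lt ((success_le_separableDual hT).trans_lt (by norm_num))⟩

theorem maxSuccess_general_mem_Ioo :
    (8514 : ℝ) / 10000 < dampingFlipEnsemble.maxSuccess .gen ∧
      dampingFlipEnsemble.maxSuccess .gen < 8515 / 10000 := by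
  have h := isGreatest_maxSuccess_dampingFlip .gen
  obtain ⟨T, hT, hmax⟩ := h.1
  exact ⟨lt_success_generalTester.trans_le (h.2 ⟨_, isTester_generalTester, rfl⟩),
    hmax.trans_lt ((success_le_generalDual hT).trans_lt (by norm_num))⟩

end ChannelDiscrimination

end

theorem theorem1 :
    ∃ E : ChannelDiscrimination.ChannelEnsemble (Fin 2) (Fin 2) 2,
      -- the equiprobable pair of an amplitude-damping and a bit-flip channel
      (∀ i, E.prob i = 1 / 2) ∧
      E.channel 0 = ChannelDiscrimination.amplitudeDamping (67 / 100) ∧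
      E.channel 1 = ChannelDiscrimination.bitFlip (87 / 100) ∧
      -- the maxima exist
      (∀ S : ChannelDiscrimination.Strategy, IsGreatest (E.successSet S) (E.maxSuccess S)) ∧
      -- their enclosures
      (8346 / 10000 < E.maxSuccess .par ∧ E.maxSuccess .par < 8347 / 10000) ∧
      (8446 / 10000 < E.maxSuccess .seq ∧ E.maxSuccess .seq < 8447 / 10000) ∧
      (8486 / 10000 < E.maxSuccess .sep ∧ E.maxSuccess .sep < 8487 / 10000) ∧
      (8514 / 10000 < E.maxSuccess .gen ∧ E.maxSuccess .gen < 8515 / 10000) ∧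
      -- the strict hierarchy
      E.maxSuccess .par < E.maxSuccess .seq ∧
      E.maxSuccess .seq < E.maxSuccess .sep ∧
      E.maxSuccess .sep < E.maxSuccess .gen := by
  have hp := ChannelDiscrimination.maxSuccess_parallel_mem_Ioo
  have hq := ChannelDiscrimination.maxSuccess_sequential_mem_Ioo
  have hs := ChannelDiscrimination.maxSuccess_separable_mem_Ioo
  have hg := ChannelDiscrimination.maxSuccess_general_mem_Ioo
  exact ⟨ChannelDiscrimination.dampingFlipEnsemble, fun _ => rfl, rfl, rfl,
    ChannelDiscrimination.isGreatest_maxSuccess_dampingFlip, hp, hq, hs, hg,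
    by linarith, by linarith, by linarith⟩
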